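/- **Setting.** Let $M=G/H$ be a homogeneous space of a connected Lie group $G$ by a connected closed subgroup $H$, with Lie algebras $\mathfrak h\subset\mathfrak g$ (for instance $G$, and hence $G/H$, simply connected). Invariant structures on $M$ are given by data on the pair $(\mathfrak g,\mathfrak h)$; on left-invariant forms, $d\alpha(X,Y)=-\alpha([X,Y])$ and $d\Omega(X,Y,Z)=-\Omega([X,Y],Z)-\Omega([Y,Z],X)-\Omega([Z,X],Y)$. * An *invariant Hermitian structure* is a pair $(g,J)$: $J\in\mathrm{End}(\mathfrak g)$ with $J\mathfrak h\subset\mathfrak h$ and, modulo $\mathfrak h$, $J^2=-1$, $\mathrm{ad}_AJ=J\,\mathrm{ad}_A$ for $A\in\mathfrak h$, and $[JX,JY]=[X,Y]+J[JX,Y]+J[X,JY]$; and a symmetric bilinear $g$ on $\mathfrak g$ with $g(\mathfrak h,\mathfrak g)=0$, $g(X,X)>0$ for $X\notin\mathfrak h$, $g([A,X],Y)+g(X,[A,Y])=0$ for $A\in\mathfrak h$, and $g(JX,JY)=g(X,Y)$. Its fundamental form is $\Omega(X,Y)=g(X,JY)$. * It is *Vaisman* if $d\Omega=\Omega\wedge\theta$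 for a nonzero closed $1$-form $\theta$ vanishing on $\mathfrak h$ (the Lee form) whose metric dual $\xi$ (the Lee field, an element of $\mathfrak g$ modulo $\mathfrak h$) is Killing: $g([\xi,X],Y)+g(X,[\xi,Y])=0$. The Reeb field is $\eta=J\xi$. * A *Vaisman pair* is a pair $(\mathfrak g,\mathfrak h)$, with $\mathfrak g$ a finite-dimensional real Lie algebra and $\mathfrak h$ a subalgebra, with such data $(g,J,\theta)$. * A derivation $\sigma$ of $\mathfrak g$ is *compatible* if it is skew for $g$, $\sigma(\mathfrak h)\subset\mathfrak h$, and $J\sigma=\sigma J$ modulo $\mathfrak h$. A *modification* of a Vaisman pair is a Vaisman pair obtained from it by a finite sequence of steps of the following two kinds, up to isomorphism: (a) for an abelian algebra $\mathfrak k$ of compatible derivations and a linear map $\phi:\mathfrak g\to\mathfrak k$ with $\phi([\mathfrak g,\mathfrak g])=0$ and $\phi(\sigma X)=0$ for all $\sigma\in\mathfrak k$, $X\in\mathfrak g$, replace the bracket by $[X,Y]+\phi(X)Y-\phi(Y)X$ and keep $\mathfrak h,g,J,\theta$; (b) for an algebra $\mathfrak k$ of compatible derivations, replace $(\mathfrak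 g,\mathfrak h)$ by $(\mathfrak g\rtimes\mathfrak k,\mathfrak h\rtimes\mathfrak k)$, with $g,J,\theta$ extended by zero to $\mathfrak k$. * An *invariant Sasaki structure* $(\psi,\eta,\widetilde J,g_1)$ on a pair $(\mathfrak g_1,\mathfrak h)$ consists of an invariant contact form $\psi$ (that is, $\psi$ vanishes on $\mathfrak h$ and $d\psi$ is nondegenerate on $\ker\psi$ modulo $\mathfrak h$) with invariant Reeb field $\eta$ ($\psi(\eta)=1$, $i(\eta)d\psi=0$), an invariant tensor $\widetilde J$ with $\widetilde J\mathfrak h\subset\mathfrak h$ and $\widetilde J^2=-1+\psi\otimes\eta$ modulo $\mathfrak h$, and an invariant metric $g_1(X,Y)=\psi(X)\psi(Y)+d\psi(\widetilde JX,Y)$, such that $\eta$ is Killing and $\widetilde J|_{\ker\psi}$ is an integrable CR structure. * A *Kähler algebra* $(\mathfrak g_2,\mathfrak k,J_2,\omega)$, which describes an invariant Kähler structure on $G_2/K$, consists of an invariant integrable complex structure $J_2$ on $(\mathfrak g_2,\mathfrak k)$ (the conditions on $J$ above) and a closed skew form $\omega$ on $\mathfrak g_2$ with $\omega(\mathfrak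 k,\mathfrak g_2)=0$, $\omega(J_2X,J_2Y)=\omega(X,Y)$, and $\omega(J_2X,X)>0$ for $X\notin\mathfrak k$. **Proposition 4.1.** Let $(\mathfrak g^0,\mathfrak h^0)$ be a Vaisman pair (for example that of a simply connected homogeneous Vaisman manifold $G/H$) such that $\mathfrak g^0$ is unimodular and $\mathfrak h^0$ contains no nonzero abelian ideal of $\mathfrak g^0$ (for example, $\mathfrak h^0$ contains no nonzero ideal, as is the case when $G$ acts effectively). Then it has a modification $(\mathfrak g,\mathfrak h,g,J,\theta)$, with $\mathfrak g$ unimodular, with the following properties. 1. $\mathfrak g_1:=\ker\theta$ is a unimodular subalgebra containing $\mathfrak h$. The Lee field and the Reeb field are represented by elements $\xi\in\mathfrak g$ and $\eta\in\mathfrak g_1$, $\eta\equiv J\xi$ modulo $\mathfrak h$, that form a basis of the center $Z(\mathfrak g)$; and $\mathfrak g=\mathbf R\xi\times\mathfrak g_1$ as a product of Lie algebras. 2. There is a $1$-form $\psi$ on $\mathfrak g$ with $\psi(\mathfrak h)=0$, $\psi(\xi)=0$ and $$\Omega=-\theta\wedge\psi+d\psi .$$ The restriction of $\psi$ to $\mathfrak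 g_1$ is the contact form, and $\eta$ is the Reeb field, of an invariant Sasaki structure $(\psi,\eta,\widetilde J,g_1)$ on $(\mathfrak g_1,\mathfrak h)$, with $\widetilde J\eta=0$, with $\widetilde J=J$ on $\ker\psi\cap\mathfrak g_1$, and with $g_1(X,Y)=g(X,Y)$ for $X\in\ker\psi\cap\mathfrak g_1$, $Y\in\mathfrak g_1$. 3. There are a Lie algebra $\mathfrak g_2$ and a central extension $$0\to\mathbf R\to\mathfrak g_1\xrightarrow{\ \pi\ }\mathfrak g_2\to0$$ sending $1\in\mathbf R$ to $\eta$, and $(\mathfrak g_2,\pi(\mathfrak h),J_2,\omega)$ is a Kähler algebra for some $J_2$ and $\omega$ with $\omega(\pi X,\pi Y)=d\psi(X,Y)$ for $X,Y\in\mathfrak g_1$; moreover, for $X\in\ker\psi\cap\mathfrak g_1$, $JX\in\mathfrak g_1$ and $J_2(\pi X)=\pi(JX)$. Furthermore $\pi(\mathfrak h)$ is the stabilizer of $\psi|_{\mathfrak g_1}$ in the coadjoint action: for $X\in\mathfrak g_1$, $\pi X\in\pi(\mathfrak h)$ if and only if $\psi([X,Y])=0$ for all $Y\in\mathfrak g_1$.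 -/

import Mathlib

universe u

attribute [local instance 100] LieRing.ofAssociativeRing

namespace HomVaisman

section Algebra

variable {L : Type u} [LieRing L] [LieAlgebra ℝ L]

/-- A Lie algebra is unimodular if every `ad X` has trace zero. -/
def IsUnimodular (L : Type u) [LieRing L] [LieAlgebra ℝ L] : Prop :=
  ∀ X : L, LinearMap.trace ℝ L (LieAlgebra.ad ℝ L X) = 0

/-- The differential of a (left-invariant) `1`-form: `dα(X, Y) = -α([X, Y])`. -/
def dOne (α : Module.Dual ℝ L) (X Y : L) : ℝ := -α ⁅X, Y⁆

/-- The differential of a (left-invariant) `2`-form: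
`dω(X, Y, Z) = -ω([X, Y], Z) - ω([Y, Z], X) - ω([Z, X], Y)`. -/
def dTwo (ω : L → L → ℝ) (X Y Z : L) : ℝ :=
  -ω ⁅X, Y⁆ Z - ω ⁅Y, Z⁆ X - ω ⁅Z, X⁆ Y

/-- The wedge product of two `1`-forms. -/
def wedgeOneOne (α β : Module.Dual ℝ L) (X Y : L) : ℝ := α X * β Y - α Y * β X

/-- The wedge product of a `2`-form and a `1`-form. -/
def wedgeTwoOne (ω : L → L → ℝ) (α : Module.Dual ℝ L) (X Y Z : L) : ℝ :=
  ω X Y * α Z + ω Y Z * α X + ω Z X * α Y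

/-- The fundamental form `Ω(X, Y) = g(X, J Y)`, so that `Ω(J X, Y) = g(X, Y)`. -/
def fundForm (J : L →ₗ[ℝ] L) (B : LinearMap.BilinForm ℝ L) (X Y : L) : ℝ := B X (J Y)

/-- An invariant integrable complex structure on the homogeneous space of the pair `(L, h)`, given
by an endomorphism `J` of `L` that preserves `h` and is considered modulo `h`. -/
structure IsInvComplex (h : LieSubalgebra ℝ L) (J : L →ₗ[ℝ] L) : Prop where
  map_isotropy : ∀ A ∈ h, J A ∈ h
  sq : ∀ X, J (J X) + X ∈ h
  invariant : ∀ A ∈ h, ∀ X, ⁅A, J X⁆ - J ⁅A, X⁆ ∈ h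
  integrable : ∀ X Y, ⁅J X, J Y⁆ - (⁅X, Y⁆ + J ⁅J X, Y⁆ + J ⁅X, J Y⁆) ∈ h

/-- An invariant Riemannian metric on the homogeneous space of the pair `(L, h)`, given by a
symmetric bilinear form on `L` that vanishes on `h`. -/
structure IsInvMetric (h : LieSubalgebra ℝ L) (B : LinearMap.BilinForm ℝ L) : Prop where
  symm : ∀ X Y, B X Y = B Y X
  isotropy : ∀ A ∈ h, ∀ X, B A X = 0
  pos : ∀ X, X ∉ h → 0 < B X X
  invariant : ∀ A ∈ h, ∀ X Y, B ⁅A, X⁆ Y + B X ⁅A, Y⁆ = 0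

/-- An invariant Hermitian structure `(B, J)` on the homogeneous space of the pair `(L, h)`. -/
structure IsHermitian (h : LieSubalgebra ℝ L) (J : L →ₗ[ℝ] L) (B : LinearMap.BilinForm ℝ L) :
    Prop where
  complex : IsInvComplex h J
  metric : IsInvMetric h B
  compatible : ∀ X Y, B (J X) (J Y) = B X Y

/-- `ξ` represents the Lee field, the metric dual of the Lee form `θ`. -/
def IsLeeVector (B : LinearMap.BilinForm ℝ L) (θ : Module.Dual ℝ L) (ξ : L) : Prop :=
  ∀ X, B ξ X = θ X

/-- An invariant Vaisman structure: an invariant Hermitian structure whose fundamental form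
satisfies `dΩ = Ω ∧ θ` for a nonzero closed `1`-form `θ` (the Lee form) whose dual field (the Lee
field) is Killing. -/
structure IsVaisman (h : LieSubalgebra ℝ L) (J : L →ₗ[ℝ] L) (B : LinearMap.BilinForm ℝ L)
    (θ : Module.Dual ℝ L) : Prop where
  hermitian : IsHermitian h J B
  lee_ne_zero : θ ≠ 0
  lee_isotropy : ∀ A ∈ h, θ A = 0
  lee_closed : ∀ X Y, dOne θ X Y = 0
  lck : ∀ X Y Z, dTwo (fundForm J B) X Y Z = wedgeTwoOne (fundForm J B) θ X Y Z
  killing : ∀ ξ, IsLeeVector B θ ξ → ∀ X Y, B ⁅ξ, X⁆ Y + B X ⁅ξ, Y⁆ = 0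

/-- An invariant Sasaki structure `(φ, η, J, B)` on the homogeneous space of the pair `(L, h)`:
`φ` is a contact form with Reeb field `η`, `J` is a `(1,1)`-tensor with `J² = -1 + φ ⊗ η`, the
metric is `B = φ ⊗ φ + dφ(J ·, ·)`, the Reeb field is Killing, and `J` restricted to `ker φ` is an
integrable CR structure. -/
structure IsSasaki (h : LieSubalgebra ℝ L) (φ : Module.Dual ℝ L) (η : L) (J : L →ₗ[ℝ] L)
    (B : LinearMap.BilinForm ℝ L) : Prop where
  form_isotropy : ∀ A ∈ h, φ A = 0
  form_invariant : ∀ A ∈ h, ∀ X, φ ⁅A, X⁆ = 0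
  contact : ∀ X, φ X = 0 → (∀ Y, φ Y = 0 → dOne φ X Y = 0) → X ∈ h
  reeb_invariant : ∀ A ∈ h, ⁅A, η⁆ ∈ h
  reeb_form : φ η = 1
  reeb_diff : ∀ X, dOne φ η X = 0
  map_isotropy : ∀ A ∈ h, J A ∈ h
  tensor_invariant : ∀ A ∈ h, ∀ X, ⁅A, J X⁆ - J ⁅A, X⁆ ∈ h
  tensor_sq : ∀ X, J (J X) - (-X + φ X • η) ∈ h
  metric : IsInvMetric h B
  metric_eq : ∀ X Y, B X Y = φ X * φ Y + dOne φ (J X) Y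
  killing : ∀ X Y, B ⁅η, X⁆ Y + B X ⁅η, Y⁆ = 0
  cr_horizontal : ∀ X Y, φ X = 0 → φ Y = 0 → φ (⁅J X, J Y⁆ - ⁅X, Y⁆) = 0
  cr_integrable : ∀ X Y, φ X = 0 → φ Y = 0 →
    ⁅J X, J Y⁆ - (⁅X, Y⁆ + J ⁅J X, Y⁆ + J ⁅X, J Y⁆) ∈ h

/-- A Kähler algebra `(L, h, J, ω)`: an invariant Kähler structure with complex structure `J` and
Kähler form `ω` on the homogeneous space of the pair `(L, h)`. -/
structure IsKahler (h : LieSubalgebra ℝ L) (J : L →ₗ[ℝ] L) (ω : LinearMap.BilinForm ℝ L) :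
    Prop where
  complex : IsInvComplex h J
  skew : ∀ X Y, ω X Y = -ω Y X
  isotropy : ∀ A ∈ h, ∀ X, ω A X = 0
  compatible : ∀ X Y, ω (J X) (J Y) = ω X Y
  closed : ∀ X Y Z, ω ⁅X, Y⁆ Z + ω ⁅Y, Z⁆ X + ω ⁅Z, X⁆ Y = 0
  pos : ∀ X, X ∉ h → 0 < ω (J X) X

end Algebra

/-- A Vaisman pair: a finite-dimensional real Lie algebra `g` with a subalgebra `h` and an
invariant Vaisman structure `(met, J)` with Lee form `θ` on the corresponding homogeneous space. -/
structure VaismanPair where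
  g : Type u
  [lieRing : LieRing g]
  [lieAlgebra : LieAlgebra ℝ g]
  [finite : FiniteDimensional ℝ g]
  h : LieSubalgebra ℝ g
  J : g →ₗ[ℝ] g
  met : LinearMap.BilinForm ℝ g
  θ : Module.Dual ℝ g
  vaisman : IsVaisman h J met θ

attribute [instance] VaismanPair.lieRing VaismanPair.lieAlgebra VaismanPair.finite

namespace VaismanPair

/-- The fundamental form. -/
def Ω (P : VaismanPair.{u}) (X Y : P.g) : ℝ := fundForm P.J P.met X Y

/-- The kernel of the Lee form. It is a subalgebra because the Lee form is closed. -/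
def g₁ (P : VaismanPair.{u}) : LieSubalgebra ℝ P.g :=
  { LinearMap.ker P.θ with
    lie_mem' := fun {X Y} _ _ => by
      have h := P.vaisman.lee_closed X Y
      simpa [dOne] using h }

/-- The isotropy subalgebra, as a subalgebra of the kernel of the Lee form. -/
def h₁ (P : VaismanPair.{u}) : LieSubalgebra ℝ P.g₁ := P.h.comap P.g₁.incl

/-- A derivation of `g` that is skew-symmetric for the metric, preserves `h` and commutes with `J`
modulo `h`. -/
def IsCompatible (P : VaismanPair.{u}) (σ : LieDerivation ℝ P.g P.g) : Prop :=
  (∀ X Y, P.met (σ X) Y + P.met X (σ Y) = 0) ∧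
  (∀ X ∈ P.h, σ X ∈ P.h) ∧
  (∀ X, P.J (σ X) - σ (P.J X) ∈ P.h)

/-- Modification by twisting the bracket. There are an abelian algebra `k` of compatible derivations
of `g` and a linear map `φ : g → k` vanishing on `[g, g]` and on all `σ X` (`σ ∈ k`, `X ∈ g`) such
that `Q` is, up to isomorphism, the vector space `g` with the same `h`, `J`, metric and Lee form and
with the new bracket `[X, Y] + φ(X) Y - φ(Y) X`. -/
def IsTwist (P Q : VaismanPair.{u}) : Prop :=
  ∃ (k : LieSubalgebra ℝ (LieDerivation ℝ P.g P.g)) (φ : P.g →ₗ[ℝ] k) (f : P.g ≃ₗ[ℝ] Q.g),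
    (∀ σ ∈ k, P.IsCompatible σ) ∧
    (∀ σ ∈ k, ∀ τ ∈ k, ⁅σ, τ⁆ = 0) ∧
    (∀ X Y : P.g, φ ⁅X, Y⁆ = 0) ∧
    (∀ σ ∈ k, ∀ X, φ (σ X) = 0) ∧
    (∀ X Y : P.g, ⁅f X, f Y⁆ =
      f (⁅X, Y⁆ + (φ X : LieDerivation ℝ P.g P.g) Y - (φ Y : LieDerivation ℝ P.g P.g) X)) ∧
    (∀ X, f X ∈ Q.h ↔ X ∈ P.h) ∧
    (∀ X, Q.J (f X) = f (P.J X)) ∧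
    (∀ X Y, Q.met (f X) (f Y) = P.met X Y) ∧
    (∀ X, Q.θ (f X) = P.θ X)

/-- Modification by enlarging the isotropy. There is an algebra `k` of compatible derivations of `g`
such that `Q` is, up to isomorphism, the pair `(g ⋊ k, h ⋊ k)`, where `J`, the metric and the Lee
form are extended by zero to `k`. -/
def IsEnlargement (P Q : VaismanPair.{u}) : Prop :=
  ∃ (k : LieSubalgebra ℝ (LieDerivation ℝ P.g P.g))
    (f : (LieAlgebra.SemiDirectSum P.g k k.incl) ≃ₗ⁅ℝ⁆ Q.g),
    (∀ σ ∈ k, P.IsCompatible σ) ∧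
    (∀ Z, f Z ∈ Q.h ↔ Z.left ∈ P.h) ∧
    (∀ Z, Q.J (f Z) = f ⟨P.J Z.left, 0⟩) ∧
    (∀ Z W, Q.met (f Z) (f W) = P.met Z.left W.left) ∧
    (∀ Z, Q.θ (f Z) = P.θ Z.left)

/-- `Q` is obtained from `P` by finitely many modifications. -/
def IsModification (P Q : VaismanPair.{u}) : Prop :=
  Relation.ReflTransGen (fun P Q => IsTwist P Q ∨ IsEnlargement P Q) P Q

end VaismanPair

end HomVaisman

open HomVaisman

/-!
The Lee vector `ξ` exists because the metric is definite modulo the isotropy. The 2-form `L_ξ Ω`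
is `J`-anti-invariant, `ξ` being Killing, while `dΩ = Ω ∧ θ` expresses it through `d(θ ∘ J)`, `(θ
∘ J) ∧ θ` and `Ω`, all of type `(1, 1)`. So it vanishes (`IsVaisman.fundForm_lie_lee`). This has
two consequences: `Ω = -θ ∧ ψ + dψ` for `ψ = -(θ ∘ J) / |ξ|²` (`IsVaisman.form_eq`), and `ad ξ`,
hence also `ad (J ξ)`, is a compatible derivation.

Twisting the bracket by `-|ξ|⁻² θ ⊗ ad ξ` makes `ξ` central (`exists_isTwist_lee_central`). Since
the isotropy elements commuting with `ker θ` form an abelian ideal of the original algebra, the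
isotropy contains no nonzero central element after the twist. If no vector congruent to
`J ξ` modulo the isotropy is central, adjoin `ad (J ξ)` to the isotropy: then `η = J ξ - ad (J ξ)` is central
(`exists_isCentralPair`), and the enlarged isotropy still contains no nonzero central element,
as such an element would make some `J ξ + A` with `A` in the isotropy central before the enlargement.

Once `ξ` and `η` are central, everything follows from `Ω = -θ ∧ ψ + dψ`. A central element killed
by `θ` and `ψ` is in the radical of `Ω`, that is, in the isotropy, so it is zero; hence `ξ` and
`η` span the center. On `ker θ` the form `ψ` is a contact form with Reeb vector `η`, and the
Sasaki identities are those of `J` restricted to `ker ψ` (`IsCentralPair.isSasaki`). Finally, a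
Sasaki structure with central Reeb vector descends to a Kähler structure on the quotient by that
vector (`IsSasaki.isKahler`).
-/

namespace HomVaisman

variable {L : Type u} [LieRing L] [LieAlgebra ℝ L] {h : LieSubalgebra ℝ L} {J : L →ₗ[ℝ] L}
  {B : LinearMap.BilinForm ℝ L} {θ : Module.Dual ℝ L} {ξ : L}

/-! ### Invariant metrics and Hermitian structures -/

theorem IsInvMetric.isotropy_right (hB : IsInvMetric h B) {A : L} (hA : A ∈ h) (X : L) :
    B X A = 0 := by
  rw [hB.symm, hB.isotropy A hA]

theorem IsInvMetric.congr_left (hB : IsInvMetric h B) {X Y : L} (hXY : X - Y ∈ h) (Z : L) :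
    B X Z = B Y Z := by
  simpa [sub_eq_zero] using hB.isotropy _ hXY Z

theorem IsInvMetric.congr_right (hB : IsInvMetric h B) {X Y : L} (hXY : X - Y ∈ h) (Z : L) :
    B Z X = B Z Y := by
  rw [hB.symm Z X, hB.symm Z Y, hB.congr_left hXY]

theorem IsInvMetric.mem_of_self_eq_zero (hB : IsInvMetric h B) {X : L} (hX : B X X = 0) :
    X ∈ h := by
  by_contra hX'
  exact (hB.pos X hX').ne' hX

theorem IsInvMetric.self_nonneg (hB : IsInvMetric h B) (X : L) : 0 ≤ B X X := by
  by_cases hX : X ∈ h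
  · rw [hB.isotropy X hX]
  · exact (hB.pos X hX).le

/-- The metric identifies the `1`-forms vanishing on the isotropy with vectors modulo the
isotropy. -/
theorem IsInvMetric.exists_isLeeVector [FiniteDimensional ℝ L] (hB : IsInvMetric h B)
    (hθ : ∀ A ∈ h, θ A = 0) : ∃ ξ, IsLeeVector B θ ξ := by
  have hθ' : θ ∈ (LinearMap.ker B).dualAnnihilator := by
    rw [Submodule.mem_dualAnnihilator]
    intro A hA
    refine hθ A (hB.mem_of_self_eq_zero ?_)
    rw [LinearMap.mem_ker] at hA
    rw [hA, LinearMap.zero_apply]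
  rw [← LinearMap.range_dualMap_eq_dualAnnihilator_ker] at hθ'
  obtain ⟨l, hl⟩ := hθ'
  obtain ⟨ξ, rfl⟩ := (Module.evalEquiv ℝ L).surjective l
  refine ⟨ξ, fun X => ?_⟩
  rw [hB.symm, ← hl]
  simp

theorem IsHermitian.form_map_left (hH : IsHermitian h J B) (X Y : L) : B (J X) Y = -B X (J Y) := by
  rw [← hH.compatible (J X) Y, hH.metric.congr_left (Y := -X) (by simpa using hH.complex.sq X)]
  simp

theorem IsHermitian.form_map_map (hH : IsHermitian h J B) (X Y : L) : B X (J (J Y)) = -B X Y := by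
  rw [hH.metric.congr_right (Y := -Y) (by simpa using hH.complex.sq Y)]
  simp

theorem IsHermitian.form_map_self (hH : IsHermitian h J B) (X : L) : B X (J X) = 0 := by
  have h1 := hH.form_map_left X X
  rw [hH.metric.symm] at h1
  linarith

/-! ### The Lee form, the Lee vector and the Reeb form -/

/-- The Reeb form `ψ = -(θ ∘ J) / |ξ|²` of a Vaisman structure with Lee form `θ` and Lee vector `ξ`,
normalized by `ψ (J ξ) = 1`; note that `|ξ|² = θ ξ`. -/
noncomputable def reebForm (J : L →ₗ[ℝ] L) (θ : Module.Dual ℝ L) (ξ : L) : Module.Dual ℝ L :=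
  (-(θ ξ)⁻¹) • (θ ∘ₗ J)

namespace IsVaisman

theorem lee_lie (hV : IsVaisman h J B θ) (X Y : L) : θ ⁅X, Y⁆ = 0 := by
  simpa [dOne] using hV.lee_closed X Y

theorem lee_congr (hV : IsVaisman h J B θ) {X Y : L} (hXY : X - Y ∈ h) : θ X = θ Y := by
  simpa [sub_eq_zero] using hV.lee_isotropy _ hXY

theorem lee_map_congr (hV : IsVaisman h J B θ) {X Y : L} (hXY : X - Y ∈ h) :
    θ (J X) = θ (J Y) := by
  apply hV.lee_congr
  rw [← map_sub]
  exact hV.hermitian.complex.map_isotropy _ hXY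

theorem lee_map_isotropy (hV : IsVaisman h J B θ) {A : L} (hA : A ∈ h) : θ (J A) = 0 :=
  hV.lee_isotropy _ (hV.hermitian.complex.map_isotropy _ hA)

theorem lee_map_map (hV : IsVaisman h J B θ) (X : L) : θ (J (J X)) = -θ X := by
  rw [hV.lee_congr (Y := -X) (by simpa using hV.hermitian.complex.sq X), map_neg]

theorem lee_map_lie_isotropy (hV : IsVaisman h J B θ) {A : L} (hA : A ∈ h) (X : L) :
    θ (J ⁅A, X⁆) = 0 := by
  rw [← hV.lee_congr (hV.hermitian.complex.invariant A hA X), hV.lee_lie]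

theorem lee_map_lie_isotropy_right (hV : IsVaisman h J B θ) {A : L} (hA : A ∈ h) (X : L) :
    θ (J ⁅X, A⁆) = 0 := by
  rw [← lie_skew, map_neg, map_neg, hV.lee_map_lie_isotropy hA, neg_zero]

/-- The differential of `θ ∘ J` is of type `(1, 1)`: apply the closed form `θ` to the integrability
condition. -/
theorem lee_map_lie_map_left (hV : IsVaisman h J B θ) (X Y : L) :
    θ (J ⁅J X, Y⁆) = -θ (J ⁅X, J Y⁆) := by
  have h1 := hV.lee_isotropy _ (hV.hermitian.complex.integrable X Y)
  simp only [map_sub, map_add, hV.lee_lie] at h1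
  linarith

theorem lee_map_lie_map_map (hV : IsVaisman h J B θ) (X Y : L) :
    θ (J ⁅J X, J Y⁆) = θ (J ⁅X, Y⁆) := by
  have h1 := hV.lee_map_lie_isotropy_right (hV.hermitian.complex.sq Y) X
  rw [lie_add, map_add, map_add] at h1
  rw [hV.lee_map_lie_map_left]
  linarith

theorem lee_pos (hV : IsVaisman h J B θ) (hξ : IsLeeVector B θ ξ) : 0 < θ ξ := by
  rw [← hξ ξ]
  refine hV.hermitian.metric.pos ξ fun hξh => hV.lee_ne_zero ?_
  ext X
  rw [← hξ X, hV.hermitian.metric.isotropy ξ hξh, LinearMap.zero_apply]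

theorem lie_isotropy_lee (hV : IsVaisman h J B θ) (hξ : IsLeeVector B θ ξ) {A : L} (hA : A ∈ h) :
    ⁅A, ξ⁆ ∈ h := by
  apply hV.hermitian.metric.mem_of_self_eq_zero
  have h1 := hV.hermitian.metric.invariant A hA ξ ⁅A, ξ⁆
  rw [hξ, hV.lee_lie] at h1
  linarith

theorem reebForm_isotropy (hV : IsVaisman h J B θ) {A : L} (hA : A ∈ h) :
    reebForm J θ ξ A = 0 := by
  simp [reebForm, hV.lee_map_isotropy hA]

theorem reebForm_congr (hV : IsVaisman h J B θ) {X Y : L} (hXY : X - Y ∈ h) :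
    reebForm J θ ξ X = reebForm J θ ξ Y := by
  simp [reebForm, hV.lee_map_congr hXY]

theorem reebForm_lee (hV : IsVaisman h J B θ) (hξ : IsLeeVector B θ ξ) : reebForm J θ ξ ξ = 0 := by
  simp [reebForm, ← hξ (J ξ), hV.hermitian.form_map_self]

theorem reebForm_map (hV : IsVaisman h J B θ) (X : L) :
    reebForm J θ ξ (J X) = θ X / θ ξ := by
  simp [reebForm, hV.lee_map_map]
  ring

theorem lee_map (hV : IsVaisman h J B θ) (hξ : IsLeeVector B θ ξ) (X : L) :
    θ (J X) = -(θ ξ * reebForm J θ ξ X) := by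
  have := (hV.lee_pos hξ).ne'
  simp [reebForm]
  field_simp

/-- The `2`-form `L_ξ Ω` is `J`-anti-invariant because `ξ` is Killing, whereas by `dΩ = Ω ∧ θ` it
equals `-d(θ ∘ J) - (θ ∘ J) ∧ θ - |ξ|² Ω`, which is `J`-invariant. Hence it vanishes. -/
theorem fundForm_lie_lee (hV : IsVaisman h J B θ) (hξ : IsLeeVector B θ ξ) (X Y : L) :
    B ⁅ξ, X⁆ (J Y) + B X (J ⁅ξ, Y⁆) = 0 ∧
      θ ξ * B X (J Y) = θ (J ⁅X, Y⁆) - θ (J X) * θ Y + θ (J Y) * θ X := by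
  have hH := hV.hermitian
  have key : ∀ X Y, B ⁅ξ, X⁆ (J Y) + B X (J ⁅ξ, Y⁆) =
      θ (J ⁅X, Y⁆) - θ (J X) * θ Y + θ (J Y) * θ X - θ ξ * B X (J Y) := by
    intro X Y
    have h1 := hV.lck ξ X Y
    have h2 : B ⁅X, Y⁆ (J ξ) = -θ (J ⁅X, Y⁆) := by
      rw [hH.metric.symm, hH.form_map_left, hξ]
    have h3 : B ⁅Y, ξ⁆ (J X) = B X (J ⁅ξ, Y⁆) := by
      rw [hH.metric.symm, hH.form_map_left, ← lie_skew, map_neg, map_neg, neg_neg]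
    have h4 : B Y (J ξ) = -θ (J Y) := by
      rw [hH.metric.symm, hH.form_map_left, hξ]
    simp only [dTwo, wedgeTwoOne, fundForm] at h1
    rw [h2, h3, h4, hξ] at h1
    linarith
  have anti : B ⁅ξ, J X⁆ (J (J Y)) + B (J X) (J ⁅ξ, J Y⁆) =
      -(B ⁅ξ, X⁆ (J Y) + B X (J ⁅ξ, Y⁆)) := by
    rw [hH.form_map_map, hH.compatible]
    have h1 := hV.killing ξ hξ (J X) Y
    have h2 := hV.killing ξ hξ X (J Y)
    have h3 := hH.form_map_left X ⁅ξ, Y⁆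
    linarith
  have h1 := key X Y
  have h2 := key (J X) (J Y)
  rw [anti, hV.lee_map_lie_map_map, hV.lee_map_map, hV.lee_map_map, hH.form_map_map,
    hH.form_map_left] at h2
  constructor <;> linarith

/-- The fundamental form of a Vaisman structure is `Ω = -θ ∧ ψ + dψ`. -/
theorem form_eq (hV : IsVaisman h J B θ) (hξ : IsLeeVector B θ ξ) (X Y : L) :
    B X (J Y) = -(θ X * reebForm J θ ξ Y - θ Y * reebForm J θ ξ X) - reebForm J θ ξ ⁅X, Y⁆ := by
  have h1 := (hV.fundForm_lie_lee hξ X Y).2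
  simp only [hV.lee_map hξ] at h1
  have h2 : θ ξ * (B X (J Y)) = θ ξ * (-(θ X * reebForm J θ ξ Y - θ Y * reebForm J θ ξ X) -
    reebForm J θ ξ ⁅X, Y⁆) := by linarith
  exact mul_left_cancel₀ (hV.lee_pos hξ).ne' h2

/-! ### The Lee field and the Reeb field are infinitesimal automorphisms -/

theorem lie_lee_map (hV : IsVaisman h J B θ) (hξ : IsLeeVector B θ ξ) (X : L) :
    J ⁅ξ, X⁆ - ⁅ξ, J X⁆ ∈ h := by
  apply hV.hermitian.metric.mem_of_self_eq_zero
  have h1 : ∀ Y, B Y (J ⁅ξ, X⁆ - ⁅ξ, J X⁆) = 0 := by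
    intro Y
    have h2 := (hV.fundForm_lie_lee hξ Y X).1
    have h3 := hV.killing ξ hξ Y (J X)
    rw [map_sub]
    linarith
  exact h1 _

theorem lie_isotropy_reeb (hV : IsVaisman h J B θ) (hξ : IsLeeVector B θ ξ) {A : L} (hA : A ∈ h) :
    ⁅A, J ξ⁆ ∈ h := by
  have h1 := hV.hermitian.complex.invariant A hA ξ
  have h2 := hV.hermitian.complex.map_isotropy _ (hV.lie_isotropy_lee hξ hA)
  simpa using h.add_mem h1 h2

theorem lie_reeb_map (hV : IsVaisman h J B θ) (hξ : IsLeeVector B θ ξ) (X : L) :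
    J ⁅J ξ, X⁆ - ⁅J ξ, J X⁆ ∈ h := by
  have h1 := hV.hermitian.complex.integrable ξ X
  have h2 := hV.hermitian.complex.map_isotropy _ (hV.lie_lee_map hξ X)
  have h3 := hV.hermitian.complex.sq ⁅ξ, X⁆
  convert! h.sub_mem (h.sub_mem h2 h3) h1 using 1
  simp only [map_sub]
  abel

theorem reebForm_lie_reeb (hV : IsVaisman h J B θ) (hξ : IsLeeVector B θ ξ) (X : L) :
    reebForm J θ ξ ⁅J ξ, X⁆ = 0 := by
  have h1 := hV.form_eq hξ (J ξ) X
  have h2 : θ (J ξ) = 0 := by rw [← hξ, hV.hermitian.form_map_self]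
  rw [hV.hermitian.compatible, hξ, h2, hV.reebForm_map, div_self (hV.lee_pos hξ).ne'] at h1
  linarith

theorem killing_reeb (hV : IsVaisman h J B θ) (hξ : IsLeeVector B θ ξ) (X Y : L) :
    B ⁅J ξ, X⁆ Y + B X ⁅J ξ, Y⁆ = 0 := by
  have hH := hV.hermitian
  have h1 : ∀ Y, B ⁅J ξ, X⁆ (J Y) + B X (J ⁅J ξ, Y⁆) = 0 := by
    intro Y
    have h2 := hV.reebForm_lie_reeb hξ ⁅X, Y⁆
    rw [leibniz_lie, map_add] at h2
    rw [hV.form_eq hξ, hV.form_eq hξ, hV.lee_lie, hV.lee_lie, hV.reebForm_lie_reeb hξ,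
      hV.reebForm_lie_reeb hξ]
    linarith
  have h3 := h1 (J Y)
  rw [hH.form_map_map, hH.metric.congr_right (hV.lie_reeb_map hξ (J Y))] at h3
  have h4 : ⁅J ξ, J (J Y)⁆ - -⁅J ξ, Y⁆ ∈ h := by
    have := hV.lie_isotropy_reeb hξ (hH.complex.sq Y)
    rw [← lie_skew, neg_mem_iff, lie_add] at this
    rwa [sub_neg_eq_add]
  rw [hH.metric.congr_right h4, map_neg] at h3
  linarith

end IsVaisman

/-! ### Twisting a Lie bracket by a derivation -/

/-- The data for twisting the bracket of `L` to `[X, Y] + t(X) σ Y - t(Y) σ X`: a derivation `σ` and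
a linear form `t` that vanishes on `[L, L]` and on the range of `σ`. This is the case of a
one-dimensional algebra of derivations. -/
structure TwistData (L : Type u) [LieRing L] [LieAlgebra ℝ L] where
  σ : LieDerivation ℝ L L
  t : Module.Dual ℝ L
  map_lie : ∀ X Y : L, t ⁅X, Y⁆ = 0
  map_der : ∀ X : L, t (σ X) = 0

/-- The vector space underlying `L`, to be endowed with the twisted bracket. -/
def Twisted {L : Type u} [LieRing L] [LieAlgebra ℝ L] (_ : TwistData L) : Type u := L

namespace Twisted

variable {L : Type u} [LieRing L] [LieAlgebra ℝ L] (D : TwistData L)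

instance : AddCommGroup (Twisted D) := inferInstanceAs (AddCommGroup L)

instance : Module ℝ (Twisted D) := inferInstanceAs (Module ℝ L)

instance [FiniteDimensional ℝ L] : FiniteDimensional ℝ (Twisted D) :=
  inferInstanceAs (FiniteDimensional ℝ L)

/-- The identity, as a linear equivalence between `L` and its twist. -/
def of : L ≃ₗ[ℝ] Twisted D := LinearEquiv.refl ℝ L

instance : Bracket (Twisted D) (Twisted D) where
  bracket X Y := of D (⁅(of D).symm X, (of D).symm Y⁆ +
    D.t ((of D).symm X) • D.σ ((of D).symm Y) - D.t ((of D).symm Y) • D.σ ((of D).symm X))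

theorem lie_def (X Y : Twisted D) : ⁅X, Y⁆ = of D (⁅(of D).symm X, (of D).symm Y⁆ +
    D.t ((of D).symm X) • D.σ ((of D).symm Y) - D.t ((of D).symm Y) • D.σ ((of D).symm X)) := rfl

theorem of_lie_of (X Y : L) :
    ⁅of D X, of D Y⁆ = of D (⁅X, Y⁆ + D.t X • D.σ Y - D.t Y • D.σ X) := by
  simp [lie_def]

instance : LieRing (Twisted D) where
  add_lie X Y Z := by
    simp only [lie_def, ← map_add]
    congr 1
    simp only [map_add, add_lie]
    module
  lie_add X Y Z := by
    simp only [lie_def, ← map_add]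
    congr 1
    simp only [map_add, lie_add]
    module
  lie_self X := by simp [lie_def]
  leibniz_lie X Y Z := by
    simp only [lie_def, ← map_add]
    congr 1
    generalize (of D).symm X = X
    generalize (of D).symm Y = Y
    generalize (of D).symm Z = Z
    simp only [LinearEquiv.symm_apply_apply, map_add, map_sub, map_smul, D.map_lie, D.map_der,
      LieDerivation.apply_lie_eq_add, lie_add, add_lie, lie_sub, sub_lie, lie_smul, smul_lie,
      smul_eq_mul, mul_zero, add_zero, sub_zero, zero_smul]
    rw [leibniz_lie X Y Z, ← lie_skew Y (D.σ X)]
    module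

instance : LieAlgebra ℝ (Twisted D) where
  lie_smul c X Y := by
    simp only [lie_def, ← map_smul]
    congr 1
    simp only [map_smul, lie_smul]
    module

theorem isUnimodular [FiniteDimensional ℝ L] (hL : IsUnimodular L)
    (hσ : LinearMap.trace ℝ L D.σ = 0) : IsUnimodular (Twisted D) := by
  intro X
  obtain ⟨X, rfl⟩ := (of D).surjective X
  have h1 : LieAlgebra.ad ℝ (Twisted D) (of D X) = (of D).conj
      (LieAlgebra.ad ℝ L X + D.t X • (D.σ : L →ₗ[ℝ] L) - D.t.smulRight (D.σ X)) := by
    ext Y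
    obtain ⟨Y, rfl⟩ := (of D).surjective Y
    simp [of_lie_of, LinearEquiv.conj_apply]
  rw [h1, LinearMap.trace_conj']
  simp [hL X, hσ, D.map_der]

end Twisted

/-- The line spanned by a derivation, as an algebra of derivations. -/
def derLine {L : Type u} [LieRing L] [LieAlgebra ℝ L] (σ : LieDerivation ℝ L L) :
    LieSubalgebra ℝ (LieDerivation ℝ L L) :=
  { Submodule.span ℝ {σ} with
    lie_mem' := fun {x y} hx hy => by
      obtain ⟨a, rfl⟩ := Submodule.mem_span_singleton.1 hx
      obtain ⟨b, rfl⟩ := Submodule.mem_span_singleton.1 hy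
      simp }

theorem mem_derLine {L : Type u} [LieRing L] [LieAlgebra ℝ L] {σ τ : LieDerivation ℝ L L} :
    τ ∈ derLine σ ↔ ∃ a : ℝ, a • σ = τ :=
  Submodule.mem_span_singleton

namespace VaismanPair

variable (P : VaismanPair.{u})

theorem isCompatible_derLine {σ : LieDerivation ℝ P.g P.g} (hσ : P.IsCompatible σ) :
    ∀ τ ∈ derLine σ, P.IsCompatible τ := by
  intro τ hτ
  obtain ⟨a, rfl⟩ := mem_derLine.1 hτ
  refine ⟨fun X Y => ?_, fun X hX => P.h.smul_mem a (hσ.2.1 X hX), fun X => ?_⟩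
  · have h1 := hσ.1 X Y
    simp only [LieDerivation.smul_apply, map_smul, LinearMap.smul_apply, smul_eq_mul]
    linear_combination a * h1
  · have h1 := P.h.smul_mem a (hσ.2.2 X)
    rwa [smul_sub, ← map_smul] at h1

theorem lee_compatible {σ : LieDerivation ℝ P.g P.g} {ξ : P.g}
    (hσ : P.IsCompatible σ) (hθ : ∀ X, P.θ (σ X) = 0) (hξ : IsLeeVector P.met P.θ ξ) :
    σ ξ ∈ P.h := by
  apply P.vaisman.hermitian.metric.mem_of_self_eq_zero
  have h1 := hσ.1 ξ (σ ξ)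
  rw [hξ, hθ] at h1
  linarith

/-- A compatible derivation is skew for the fundamental form. -/
theorem fundForm_compatible {σ : LieDerivation ℝ P.g P.g} (hσ : P.IsCompatible σ) (X Y : P.g) :
    P.met (σ X) (P.J Y) - P.met (σ Y) (P.J X) = 0 := by
  have hH := P.vaisman.hermitian
  have h1 := hσ.1 X (P.J Y)
  have h2 := hH.form_map_left X (σ Y)
  rw [hH.metric.symm (σ Y), h2, hH.metric.congr_right (hσ.2.2 Y) X]
  linarith

/-- The twist of a Vaisman pair by a compatible derivation `σ` whose range is contained in the
kernel of the Lee form. -/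
noncomputable def twist (D : TwistData P.g) (hσ : P.IsCompatible D.σ)
    (hθ : ∀ X, P.θ (D.σ X) = 0) : VaismanPair.{u} where
  g := Twisted D
  h :=
    { P.h.toSubmodule.comap (Twisted.of D).symm.toLinearMap with
      lie_mem' := fun {X Y} hX hY => P.h.sub_mem (P.h.add_mem (P.h.lie_mem hX hY)
        (P.h.smul_mem _ (hσ.2.1 _ hY))) (P.h.smul_mem _ (hσ.2.1 _ hX)) }
  J := (Twisted.of D).conj P.J
  met := P.met.compl₁₂ (Twisted.of D).symm.toLinearMap (Twisted.of D).symm.toLinearMap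
  θ := P.θ ∘ₗ (Twisted.of D).symm.toLinearMap
  vaisman := by
    have hV := P.vaisman
    have hH := hV.hermitian
    have inv : ∀ A ∈ P.h, ∀ X Y, P.met (⁅A, X⁆ + D.t A • D.σ X - D.t X • D.σ A) Y +
        P.met X (⁅A, Y⁆ + D.t A • D.σ Y - D.t Y • D.σ A) = 0 := by
      intro A hA X Y
      have h1 := hH.metric.invariant A hA X Y
      have h2 := hσ.1 X Y
      simp only [map_add, map_sub, map_smul, LinearMap.add_apply, LinearMap.sub_apply,
        LinearMap.smul_apply, smul_eq_mul, hH.metric.isotropy _ (hσ.2.1 A hA),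
        hH.metric.isotropy_right (hσ.2.1 A hA)]
      linear_combination h1 + D.t A * h2
    refine ⟨⟨⟨?_, ?_, ?_, ?_⟩, ⟨?_, ?_, ?_, ?_⟩, ?_⟩, ?_, ?_, ?_, ?_, ?_⟩
    · exact fun A hA => hH.complex.map_isotropy _ hA
    · exact fun X => hH.complex.sq _
    · intro (A : P.g) (hA : A ∈ P.h) (X : P.g)
      change (⁅A, P.J X⁆ + D.t A • D.σ (P.J X) - D.t (P.J X) • D.σ A) -
        P.J (⁅A, X⁆ + D.t A • D.σ X - D.t X • D.σ A) ∈ P.h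
      convert! P.h.add_mem (P.h.sub_mem (P.h.sub_mem (hH.complex.invariant A hA X)
        (P.h.smul_mem (D.t A) (hσ.2.2 X))) (P.h.smul_mem (D.t (P.J X)) (hσ.2.1 A hA)))
        (P.h.smul_mem (D.t X) (hH.complex.map_isotropy _ (hσ.2.1 A hA))) using 1
      simp only [map_add, map_sub, map_smul]
      module
    · intro (X : P.g) (Y : P.g)
      change (⁅P.J X, P.J Y⁆ + D.t (P.J X) • D.σ (P.J Y) - D.t (P.J Y) • D.σ (P.J X)) -
        ((⁅X, Y⁆ + D.t X • D.σ Y - D.t Y • D.σ X) +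
          P.J (⁅P.J X, Y⁆ + D.t (P.J X) • D.σ Y - D.t Y • D.σ (P.J X)) +
          P.J (⁅X, P.J Y⁆ + D.t X • D.σ (P.J Y) - D.t (P.J Y) • D.σ X)) ∈ P.h
      have h1 : ∀ X, P.J (D.σ (P.J X)) + D.σ X ∈ P.h := by
        intro X
        convert! P.h.add_mem (hσ.2.2 (P.J X)) (hσ.2.1 _ (hH.complex.sq X)) using 1
        simp only [map_add]
        abel
      convert! P.h.sub_mem (P.h.add_mem (P.h.add_mem (P.h.sub_mem (hH.complex.integrable X Y)
        (P.h.smul_mem (D.t (P.J X)) (hσ.2.2 Y))) (P.h.smul_mem (D.t (P.J Y)) (hσ.2.2 X)))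
        (P.h.smul_mem (D.t Y) (h1 X))) (P.h.smul_mem (D.t X) (h1 Y)) using 1
      simp only [map_add, map_sub, map_smul]
      module
    · exact fun X Y => hH.metric.symm _ _
    · exact fun A hA X => hH.metric.isotropy _ hA _
    · exact fun X hX => hH.metric.pos _ hX
    · exact fun A hA X Y => inv A hA X Y
    · exact fun X Y => hH.compatible _ _
    · exact fun hθ0 => hV.lee_ne_zero (LinearMap.ext fun X => LinearMap.congr_fun hθ0 X)
    · exact fun A hA => hV.lee_isotropy _ hA
    · intro (X : P.g) (Y : P.g)
      change -P.θ (⁅X, Y⁆ + D.t X • D.σ Y - D.t Y • D.σ X) = 0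
      simp [hV.lee_lie, hθ]
    · intro (X : P.g) (Y : P.g) (Z : P.g)
      have h1 := hV.lck X Y Z
      have h2 := P.fundForm_compatible hσ
      change -P.met (⁅X, Y⁆ + D.t X • D.σ Y - D.t Y • D.σ X) (P.J Z) -
        P.met (⁅Y, Z⁆ + D.t Y • D.σ Z - D.t Z • D.σ Y) (P.J X) -
        P.met (⁅Z, X⁆ + D.t Z • D.σ X - D.t X • D.σ Z) (P.J Y) =
        wedgeTwoOne (fundForm P.J P.met) P.θ X Y Z
      rw [← h1]
      simp only [dTwo, fundForm, map_add, map_sub, map_smul, LinearMap.add_apply,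
        LinearMap.sub_apply, LinearMap.smul_apply, smul_eq_mul]
      linear_combination -D.t X * h2 Y Z - D.t Y * h2 Z X - D.t Z * h2 X Y
    · intro (ξ : P.g) hξ (X : P.g) (Y : P.g)
      have hξ' : IsLeeVector P.met P.θ ξ := hξ
      have h1 := P.lee_compatible hσ hθ hξ'
      change P.met (⁅ξ, X⁆ + D.t ξ • D.σ X - D.t X • D.σ ξ) Y +
        P.met X (⁅ξ, Y⁆ + D.t ξ • D.σ Y - D.t Y • D.σ ξ) = 0
      simp only [map_add, map_sub, map_smul, LinearMap.add_apply, LinearMap.sub_apply,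
        LinearMap.smul_apply, smul_eq_mul, hH.metric.isotropy _ h1, hH.metric.isotropy_right h1]
      linear_combination hV.killing ξ hξ' X Y + D.t ξ * hσ.1 X Y

theorem isTwist_twist (D : TwistData P.g) (hσ : P.IsCompatible D.σ)
    (hθ : ∀ X, P.θ (D.σ X) = 0) : P.IsTwist (P.twist D hσ hθ) := by
  refine ⟨derLine D.σ, D.t.smulRight ⟨D.σ, Submodule.mem_span_singleton_self _⟩, Twisted.of D,
    ?_, ?_, ?_, ?_, ?_, ?_, ?_, ?_, ?_⟩
  · exact P.isCompatible_derLine hσ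
  · intro σ hσ τ hτ
    obtain ⟨a, rfl⟩ := mem_derLine.1 hσ
    obtain ⟨b, rfl⟩ := mem_derLine.1 hτ
    simp
  · intro X Y
    simp [D.map_lie]
  · intro σ hσ X
    obtain ⟨a, rfl⟩ := mem_derLine.1 hσ
    simp [D.map_der]
  · intro X Y
    exact Twisted.of_lie_of D X Y
  · exact fun X => Iff.rfl
  · exact fun X => rfl
  · exact fun X Y => rfl
  · exact fun X => rfl

/-! ### Enlarging the isotropy by derivations -/

instance {L : Type u} [LieRing L] [LieAlgebra ℝ L] [FiniteDimensional ℝ L]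
    (k : LieSubalgebra ℝ (LieDerivation ℝ L L)) :
    FiniteDimensional ℝ (LieAlgebra.SemiDirectSum L k k.incl) :=
  Module.Finite.equiv (LieAlgebra.SemiDirectSum.toProdl k.incl).symm

/-- The enlargement of a Vaisman pair by an algebra `k` of compatible derivations whose ranges are
contained in the kernel of the Lee form. -/
noncomputable def enlarge (k : LieSubalgebra ℝ (LieDerivation ℝ P.g P.g))
    (hk : ∀ σ ∈ k, P.IsCompatible σ) (hθ : ∀ σ ∈ k, ∀ X, P.θ (σ X) = 0) : VaismanPair.{u} where
  g := LieAlgebra.SemiDirectSum P.g k k.incl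
  h :=
    { P.h.toSubmodule.comap (LieAlgebra.SemiDirectSum.projl k.incl) with
      lie_mem' := fun {Z W} hZ hW => P.h.sub_mem (P.h.add_mem (P.h.lie_mem hZ hW)
        ((hk _ Z.right.2).2.1 _ hW)) ((hk _ W.right.2).2.1 _ hZ) }
  J := (LieAlgebra.SemiDirectSum.inl k.incl : P.g →ₗ[ℝ] _) ∘ₗ P.J ∘ₗ
    LieAlgebra.SemiDirectSum.projl k.incl
  met := P.met.compl₁₂ (LieAlgebra.SemiDirectSum.projl k.incl)
    (LieAlgebra.SemiDirectSum.projl k.incl)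
  θ := P.θ ∘ₗ LieAlgebra.SemiDirectSum.projl k.incl
  vaisman := by
    have hV := P.vaisman
    have hH := hV.hermitian
    have killing : ∀ σ ∈ k, ∀ τ ∈ k, ∀ τ' ∈ k, ∀ ξ X Y : P.g,
        P.met ⁅ξ, X⁆ Y + P.met X ⁅ξ, Y⁆ = 0 → (∀ τ ∈ k, τ ξ ∈ P.h) →
        P.met (⁅ξ, X⁆ + σ X - τ ξ) Y + P.met X (⁅ξ, Y⁆ + σ Y - τ' ξ) = 0 := by
      intro σ hσ τ hτ τ' hτ' ξ X Y h1 h2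
      simp only [map_add, map_sub, LinearMap.add_apply, LinearMap.sub_apply,
        hH.metric.isotropy _ (h2 τ hτ), hH.metric.isotropy_right (h2 τ' hτ')]
      linear_combination h1 + (hk σ hσ).1 X Y
    refine ⟨⟨⟨?_, ?_, ?_, ?_⟩, ⟨?_, ?_, ?_, ?_⟩, ?_⟩, ?_, ?_, ?_, ?_, ?_⟩
    · exact fun A hA => hH.complex.map_isotropy _ hA
    · exact fun X => hH.complex.sq _
    · rintro ⟨A, σ⟩ (hA : A ∈ P.h) ⟨X, τ⟩
      change (⁅A, P.J X⁆ + σ.1 (P.J X) - (0 : LieDerivation ℝ P.g P.g) A) -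
        P.J (⁅A, X⁆ + σ.1 X - τ.1 A) ∈ P.h
      convert! P.h.add_mem (P.h.sub_mem (hH.complex.invariant A hA X) ((hk σ σ.2).2.2 X))
        (hH.complex.map_isotropy _ ((hk τ τ.2).2.1 A hA)) using 1
      simp only [map_add, map_sub, LieDerivation.zero_apply]
      abel
    · rintro ⟨X, σ⟩ ⟨Y, τ⟩
      change (⁅P.J X, P.J Y⁆ + (0 : LieDerivation ℝ P.g P.g) (P.J Y) -
          (0 : LieDerivation ℝ P.g P.g) (P.J X)) -
        ((⁅X, Y⁆ + σ.1 Y - τ.1 X) +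
          P.J (⁅P.J X, Y⁆ + (0 : LieDerivation ℝ P.g P.g) Y - τ.1 (P.J X)) +
          P.J (⁅X, P.J Y⁆ + σ.1 (P.J Y) - (0 : LieDerivation ℝ P.g P.g) X)) ∈ P.h
      have h1 : ∀ σ ∈ k, ∀ X, P.J (σ (P.J X)) + σ X ∈ P.h := by
        intro σ hσ X
        convert! P.h.add_mem ((hk σ hσ).2.2 (P.J X)) ((hk σ hσ).2.1 _ (hH.complex.sq X)) using 1
        simp only [map_add]
        abel
      convert! P.h.add_mem (P.h.sub_mem (hH.complex.integrable X Y) (h1 σ σ.2 Y)) (h1 τ τ.2 X)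
        using 1
      simp only [map_add, map_sub, LieDerivation.zero_apply]
      abel
    · exact fun X Y => hH.metric.symm _ _
    · exact fun A hA X => hH.metric.isotropy _ hA _
    · exact fun X hX => hH.metric.pos _ hX
    · rintro ⟨A, σ⟩ (hA : A ∈ P.h) ⟨X, τ⟩ ⟨Y, τ'⟩
      exact killing σ σ.2 τ τ.2 τ' τ'.2 A X Y (hH.metric.invariant A hA X Y)
        fun τ hτ => (hk τ hτ).2.1 A hA
    · exact fun X Y => hH.compatible _ _
    · exact fun hθ0 => hV.lee_ne_zero (LinearMap.ext fun X => LinearMap.congr_fun hθ0 ⟨X, 0⟩)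
    · exact fun A hA => hV.lee_isotropy _ hA
    · rintro ⟨X, σ⟩ ⟨Y, τ⟩
      change -P.θ (⁅X, Y⁆ + σ.1 Y - τ.1 X) = 0
      simp [hV.lee_lie, hθ σ.1 σ.2, hθ τ.1 τ.2]
    · rintro ⟨X, σ⟩ ⟨Y, τ⟩ ⟨Z, ρ⟩
      have h1 := hV.lck X Y Z
      change -P.met (⁅X, Y⁆ + σ.1 Y - τ.1 X) (P.J Z) -
        P.met (⁅Y, Z⁆ + τ.1 Z - ρ.1 Y) (P.J X) - P.met (⁅Z, X⁆ + ρ.1 X - σ.1 Z) (P.J Y) =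
        wedgeTwoOne (fundForm P.J P.met) P.θ X Y Z
      rw [← h1]
      simp only [dTwo, fundForm, map_add, map_sub, LinearMap.add_apply, LinearMap.sub_apply]
      linear_combination -P.fundForm_compatible (hk σ σ.2) Y Z -
        P.fundForm_compatible (hk τ τ.2) Z X - P.fundForm_compatible (hk ρ ρ.2) X Y
    · rintro ⟨ξ, σ⟩ hξ ⟨X, τ⟩ ⟨Y, τ'⟩
      have hξ' : IsLeeVector P.met P.θ ξ := fun X => hξ ⟨X, 0⟩
      exact killing σ σ.2 τ τ.2 τ' τ'.2 ξ X Y (hV.killing ξ hξ' X Y)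
        fun τ hτ => P.lee_compatible (hk τ hτ) (hθ τ hτ) hξ'

theorem isEnlargement_enlarge (k : LieSubalgebra ℝ (LieDerivation ℝ P.g P.g))
    (hk : ∀ σ ∈ k, P.IsCompatible σ) (hθ : ∀ σ ∈ k, ∀ X, P.θ (σ X) = 0) :
    P.IsEnlargement (P.enlarge k hk hθ) :=
  ⟨k, LieEquiv.refl, hk, fun _ => Iff.rfl, fun _ => rfl, fun _ _ => rfl, fun _ => rfl⟩

end VaismanPair

/-! ### The Kähler quotient of a Sasaki structure with central Reeb field -/

section Kahler

variable {L : Type u} [LieRing L] [LieAlgebra ℝ L]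

/-- The ideal spanned by a central element. -/
def centralLine (η : L) (hη : ∀ X : L, ⁅X, η⁆ = 0) : LieIdeal ℝ L :=
  { Submodule.span ℝ {η} with
    lie_mem := fun {X Y} hY => by
      obtain ⟨a, rfl⟩ := Submodule.mem_span_singleton.1 hY
      simp [hη] }

theorem mem_centralLine {η : L} {hη : ∀ X : L, ⁅X, η⁆ = 0} {X : L} :
    X ∈ centralLine η hη ↔ ∃ a : ℝ, a • η = X :=
  Submodule.mem_span_singleton

/-- The inclusion `ℝ → L` of the line spanned by a central element. -/
def centralIncl (η : L) : ℝ →ₗ⁅ℝ⁆ L :=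
  { LinearMap.toSpanSingleton ℝ L η with
    map_lie' := fun {s t} => by simp [mul_comm s t, Ring.lie_def] }

theorem centralIncl_apply (η : L) (t : ℝ) : centralIncl η t = t • η := rfl

variable (η : L) (hη : ∀ X : L, ⁅X, η⁆ = 0)

/-- The projection onto the quotient by a central line. -/
def centralProj : L →ₗ⁅ℝ⁆ L ⧸ centralLine η hη :=
  { (centralLine η hη).toSubmodule.mkQ with
    map_lie' := fun {_ _} => LieSubmodule.Quotient.mk_bracket _ _ _ }

theorem centralProj_surjective : Function.Surjective (centralProj η hη) :=
  Submodule.mkQ_surjective _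

theorem centralProj_eq_iff {X Y : L} :
    centralProj η hη X = centralProj η hη Y ↔ ∃ a : ℝ, a • η = X - Y :=
  (Submodule.Quotient.eq _).trans mem_centralLine

theorem centralProj_self : centralProj η hη η = 0 := by
  rw [← map_zero (centralProj η hη), centralProj_eq_iff]
  exact ⟨1, by simp⟩

theorem isExtension_central (h0 : η ≠ 0) :
    LieAlgebra.IsExtension (centralIncl η) (centralProj η hη) where
  ker_eq_bot := by
    rw [LieHom.ker_eq_bot]
    intro s t hst
    exact smul_left_injective ℝ h0 hst
  range_eq_top := (LieHom.range_eq_top _).2 (centralProj_surjective η hη)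
  exact := by
    ext X
    rw [LieHom.mem_range, LieIdeal.mem_toLieSubalgebra, LieHom.mem_ker,
      ← map_zero (centralProj η hη), centralProj_eq_iff, sub_zero]
    rfl

variable {η} (φ : Module.Dual ℝ L) (hφ : φ η = 1)

/-- The linear section of the projection along a central line `ℝ η`, with values in the kernel of a
linear form `φ` with `φ η = 1`. -/
def horizontalLift : L ⧸ centralLine η hη →ₗ[ℝ] L :=
  (centralLine η hη).toSubmodule.liftQ (LinearMap.id - φ.smulRight η) <| by
    intro X hX
    obtain ⟨a, rfl⟩ := mem_centralLine.1 hX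
    simp [hφ]

theorem horizontalLift_proj (X : L) :
    horizontalLift hη φ hφ (centralProj η hη X) = X - φ X • η := rfl

theorem form_horizontalLift (a : L ⧸ centralLine η hη) : φ (horizontalLift hη φ hφ a) = 0 := by
  obtain ⟨X, rfl⟩ := centralProj_surjective η hη a
  simp [horizontalLift_proj, hφ]

theorem proj_horizontalLift (a : L ⧸ centralLine η hη) :
    centralProj η hη (horizontalLift hη φ hφ a) = a := by
  obtain ⟨X, rfl⟩ := centralProj_surjective η hη a
  simp [horizontalLift_proj, centralProj_self]

/-- The endomorphism of the quotient by `ℝ η` induced by an endomorphism of `ker φ`. -/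
def quotientTensor (J : L →ₗ[ℝ] L) : L ⧸ centralLine η hη →ₗ[ℝ] L ⧸ centralLine η hη :=
  (centralProj η hη : L →ₗ[ℝ] _) ∘ₗ J ∘ₗ horizontalLift hη φ hφ

theorem quotientTensor_proj {J : L →ₗ[ℝ] L} (hJ : J η = 0) (X : L) :
    quotientTensor hη φ hφ J (centralProj η hη X) = centralProj η hη (J X) := by
  simp [quotientTensor, horizontalLift_proj, hJ]

/-- The skew form on the quotient by `ℝ η` whose pull-back is `dφ`. -/
def quotientForm : LinearMap.BilinForm ℝ (L ⧸ centralLine η hη) :=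
  LinearMap.mk₂ ℝ (fun a b => dOne φ (horizontalLift hη φ hφ a) (horizontalLift hη φ hφ b))
    (fun a b c => by simp [dOne]; ring) (fun a b c => by simp [dOne])
    (fun a b c => by simp [dOne]; ring) (fun a b c => by simp [dOne])

theorem quotientForm_proj (X Y : L) :
    quotientForm hη φ hφ (centralProj η hη X) (centralProj η hη Y) = dOne φ X Y := by
  have hη' : ∀ X : L, ⁅η, X⁆ = 0 := fun X => by rw [← lie_skew, hη, neg_zero]
  simp [quotientForm, horizontalLift_proj, dOne, hη, hη']

variable {hη φ} {h : LieSubalgebra ℝ L} {J : L →ₗ[ℝ] L} {B : LinearMap.BilinForm ℝ L}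

theorem IsSasaki.proj_mem_iff (hS : IsSasaki h φ η J B) {X : L} (hX : φ X = 0) :
    centralProj η hη X ∈ h.map (centralProj η hη) ↔ X ∈ h := by
  refine ⟨fun ⟨A, hA, hAX⟩ => ?_, fun hX => (LieSubalgebra.mem_map _ _ _).2 ⟨X, hX, rfl⟩⟩
  obtain ⟨a, ha⟩ := (centralProj_eq_iff η hη).1 hAX
  have h1 := congrArg φ ha
  have h2 : a = 0 := by simpa [hS.reeb_form, hX, hS.form_isotropy A hA] using h1
  rw [h2, zero_smul, eq_comm, sub_eq_zero] at ha
  exact ha ▸ hA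

/-- The isotropy of the Kähler quotient is the stabilizer of the contact form in the coadjoint
action. -/
theorem IsSasaki.proj_mem_iff_stabilizer (hS : IsSasaki h φ η J B) (X : L) :
    centralProj η hη X ∈ h.map (centralProj η hη) ↔ ∀ Y, φ ⁅X, Y⁆ = 0 := by
  have hη' : ∀ X : L, ⁅η, X⁆ = 0 := fun X => by rw [← lie_skew, hη, neg_zero]
  have h1 : φ (X - φ X • η) = 0 := by simp [hS.reeb_form]
  have h2 : centralProj η hη X = centralProj η hη (X - φ X • η) := by
    simp [centralProj_self]
  have h3 : ∀ Y, φ ⁅X, Y⁆ = φ ⁅X - φ X • η, Y⁆ := fun Y => by simp [hη']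
  simp_rw [h2, hS.proj_mem_iff h1, h3]
  refine ⟨fun hX Y => hS.form_invariant _ hX Y, fun hX => hS.contact _ h1 fun Y _ => ?_⟩
  rw [dOne, hX, neg_zero]

/-- An invariant Sasaki structure whose Reeb field is a central element `η` induces an invariant
Kähler structure on the quotient by `ℝ η`. -/
theorem IsSasaki.isKahler (hS : IsSasaki h φ η J B) (hJ : J η = 0) :
    IsKahler (h.map (centralProj η hη)) (quotientTensor hη φ hS.reeb_form J)
      (quotientForm hη φ hS.reeb_form) := by
  have hmem : ∀ {X : L}, X ∈ h → centralProj η hη X ∈ h.map (centralProj η hη) :=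
    fun hX => (LieSubalgebra.mem_map _ _ _).2 ⟨_, hX, rfl⟩
  have lift : ∀ a : L ⧸ centralLine η hη, ∃ X, φ X = 0 ∧ centralProj η hη X = a := fun a =>
    ⟨_, form_horizontalLift hη φ hS.reeb_form a, proj_horizontalLift hη φ hS.reeb_form a⟩
  have hJπ := quotientTensor_proj hη φ hS.reeb_form hJ
  have hω := quotientForm_proj hη φ hS.reeb_form
  refine ⟨⟨?_, ?_, ?_, ?_⟩, ?_, ?_, ?_, ?_, ?_⟩
  · rintro _ ⟨A, hA, rfl⟩
    change quotientTensor hη φ hS.reeb_form J (centralProj η hη A) ∈ _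
    rw [hJπ]
    exact hmem (hS.map_isotropy A hA)
  · intro a
    obtain ⟨X, hX, rfl⟩ := lift a
    rw [hJπ, hJπ, ← map_add]
    apply hmem
    have h1 := hS.tensor_sq X
    rwa [hX, zero_smul, add_zero, sub_neg_eq_add] at h1
  · rintro _ ⟨A, hA, rfl⟩ a
    obtain ⟨X, rfl⟩ := centralProj_surjective η hη a
    change ⁅centralProj η hη A, _⁆ - quotientTensor hη φ hS.reeb_form J ⁅centralProj η hη A, _⁆ ∈ _
    rw [hJπ, ← LieHom.map_lie, ← LieHom.map_lie, hJπ, ← map_sub]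
    exact hmem (hS.tensor_invariant A hA X)
  · intro a b
    obtain ⟨X, hX, rfl⟩ := lift a
    obtain ⟨Y, hY, rfl⟩ := lift b
    simp only [hJπ, ← LieHom.map_lie]
    rw [← map_add, ← map_add, ← map_sub]
    exact hmem (hS.cr_integrable X Y hX hY)
  · intro a b
    obtain ⟨X, rfl⟩ := centralProj_surjective η hη a
    obtain ⟨Y, rfl⟩ := centralProj_surjective η hη b
    rw [hω, hω, dOne, dOne, ← lie_skew, map_neg]
  · rintro _ ⟨A, hA, rfl⟩ a
    obtain ⟨X, rfl⟩ := centralProj_surjective η hη a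
    change quotientForm hη φ hS.reeb_form (centralProj η hη A) _ = 0
    rw [hω, dOne, hS.form_invariant A hA, neg_zero]
  · intro a b
    obtain ⟨X, hX, rfl⟩ := lift a
    obtain ⟨Y, hY, rfl⟩ := lift b
    have h1 := hS.cr_horizontal X Y hX hY
    rw [map_sub, sub_eq_zero] at h1
    rw [hJπ, hJπ, hω, hω, dOne, dOne, h1]
  · intro a b c
    obtain ⟨X, rfl⟩ := centralProj_surjective η hη a
    obtain ⟨Y, rfl⟩ := centralProj_surjective η hη b
    obtain ⟨Z, rfl⟩ := centralProj_surjective η hη c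
    simp only [← LieHom.map_lie, hω, dOne]
    have h1 := congrArg φ (lie_jacobi X Y Z)
    rw [← lie_skew X, ← lie_skew Y ⁅Z, X⁆, ← lie_skew Z ⁅X, Y⁆] at h1
    simp only [map_add, map_neg, map_zero] at h1
    linarith
  · intro a ha
    obtain ⟨X, hX, rfl⟩ := lift a
    rw [hS.proj_mem_iff hX] at ha
    have h1 := hS.metric_eq X X
    rw [hX, mul_zero, zero_add] at h1
    rw [hJπ, hω, ← h1]
    exact hS.metric.pos X ha

end Kahler

namespace VaismanPair

/-! ### Vaisman pairs whose Lee field and Reeb field are central -/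

/-- `ξ` and `η` are central elements of `g` that represent the Lee field and the Reeb field. -/
structure IsCentralPair (Q : VaismanPair.{u}) (ξ : Q.g) (η : Q.g₁) : Prop where
  lee : IsLeeVector Q.met Q.θ ξ
  reeb : (η : Q.g) - Q.J ξ ∈ Q.h
  lee_central : ∀ X : Q.g, ⁅X, ξ⁆ = 0
  reeb_central : ∀ X : Q.g, ⁅X, (η : Q.g)⁆ = 0

variable {Q : VaismanPair.{u}} {ξ : Q.g} {η : Q.g₁}

theorem mem_g₁ {X : Q.g} : X ∈ Q.g₁ ↔ Q.θ X = 0 := Iff.rfl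

theorem lee_coe (X : Q.g₁) : Q.θ (X : Q.g) = 0 := X.2

theorem h_le_g₁ (Q : VaismanPair.{u}) : Q.h ≤ Q.g₁ := fun A hA => Q.vaisman.lee_isotropy A hA

theorem isUnimodular_g₁ (hU : IsUnimodular Q.g) : IsUnimodular Q.g₁ := by
  intro X
  have h1 : ∀ Y, LieAlgebra.ad ℝ Q.g (X : Q.g) Y ∈ Q.g₁.toSubmodule :=
    fun Y => Q.vaisman.lee_lie X Y
  rw [← hU X, ← LinearMap.trace_restrict_eq_of_forall_mem _ _ h1]
  rfl

namespace IsCentralPair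

theorem reebForm_reeb (hc : Q.IsCentralPair ξ η) : reebForm Q.J Q.θ ξ η = 1 := by
  rw [Q.vaisman.reebForm_congr hc.reeb, Q.vaisman.reebForm_map,
    div_self (Q.vaisman.lee_pos hc.lee).ne']

theorem linearIndependent (hc : Q.IsCentralPair ξ η) : LinearIndependent ℝ ![ξ, (η : Q.g)] := by
  rw [LinearIndependent.pair_iff]
  intro s t hst
  have h1 := congrArg Q.θ hst
  have h2 := congrArg (reebForm Q.J Q.θ ξ) hst
  simp only [map_add, map_smul, lee_coe, smul_eq_mul, mul_zero, add_zero, map_zero,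
    hc.reebForm_reeb, Q.vaisman.reebForm_lee hc.lee, mul_one, zero_add] at h1 h2
  exact ⟨(mul_eq_zero.1 h1).resolve_right (Q.vaisman.lee_pos hc.lee).ne', h2⟩

/-- By `Ω = -θ ∧ ψ + dψ`, a central element on which `θ` and `ψ` vanish lies in the isotropy. -/
theorem center_eq (hc : Q.IsCentralPair ξ η)
    (h0 : ∀ A ∈ Q.h, (∀ X : Q.g, ⁅X, A⁆ = 0) → A = 0) :
    (LieAlgebra.center ℝ Q.g).toSubmodule = Submodule.span ℝ {ξ, (η : Q.g)} := by
  have hpos := (Q.vaisman.lee_pos hc.lee).ne'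
  apply le_antisymm
  · intro Z hZ
    have hZ' : ∀ X : Q.g, ⁅X, Z⁆ = 0 := (LieModule.mem_maxTrivSubmodule ℝ Q.g Q.g Z).1 hZ
    set ψ := reebForm Q.J Q.θ ξ with hψ
    set W := Z - (Q.θ Z / Q.θ ξ) • ξ - ψ Z • (η : Q.g) with hW
    have hWc : ∀ X : Q.g, ⁅X, W⁆ = 0 := fun X => by
      simp [hW, hZ', hc.lee_central, hc.reeb_central]
    have hθW : Q.θ W = 0 := by
      simp [hW, lee_coe, hpos]
    have hψW : ψ W = 0 := by
      simp [hW, hψ, hc.reebForm_reeb, Q.vaisman.reebForm_lee hc.lee]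
    have hWh : W ∈ Q.h := by
      apply Q.vaisman.hermitian.metric.mem_of_self_eq_zero
      have h1 := Q.vaisman.form_eq hc.lee W (Q.J W)
      rw [Q.vaisman.hermitian.form_map_map, ← lie_skew, hWc, ← hψ, hθW, hψW] at h1
      simpa using h1
    have hZW : Z = (Q.θ Z / Q.θ ξ) • ξ + ψ Z • (η : Q.g) := by
      have := h0 W hWh hWc
      rw [hW, sub_sub, sub_eq_zero] at this
      exact this
    exact Submodule.mem_span_pair.2 ⟨_, _, hZW.symm⟩
  · rw [Submodule.span_le]
    rintro _ (rfl | rfl)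
    · exact (LieModule.mem_maxTrivSubmodule ℝ Q.g Q.g _).2 hc.lee_central
    · exact (LieModule.mem_maxTrivSubmodule ℝ Q.g Q.g _).2 hc.reeb_central

theorem exists_prodEquiv (hc : Q.IsCentralPair ξ η) :
    ∃ e : (ℝ × Q.g₁) ≃ₗ⁅ℝ⁆ Q.g, ∀ (t : ℝ) (X : Q.g₁), e (t, X) = t • ξ + (X : Q.g) := by
  have hpos := (Q.vaisman.lee_pos hc.lee).ne'
  have hξ : ∀ X : Q.g, ⁅ξ, X⁆ = 0 := fun X => by rw [← lie_skew, hc.lee_central, neg_zero]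
  let f : (ℝ × Q.g₁) →ₗ⁅ℝ⁆ Q.g :=
    { toFun := fun p => p.1 • ξ + (p.2 : Q.g)
      map_add' := fun p q => by simp [add_smul]; abel
      map_smul' := fun a p => by simp [smul_smul]
      map_lie' := fun {p q} => by simp [hξ, hc.lee_central, LieRing.of_associative_ring_bracket,
        mul_comm] }
  have hf : ∀ p, f p = p.1 • ξ + (p.2 : Q.g) := fun p => rfl
  have hθ : ∀ p, Q.θ (f p) = p.1 * Q.θ ξ := fun p => by simp [hf, lee_coe]
  refine ⟨LieEquiv.ofBijective f ⟨?_, ?_⟩, fun t X => rfl⟩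
  · rintro ⟨s, X⟩ ⟨t, Y⟩ hst
    have h1 := congrArg Q.θ hst
    rw [hθ, hθ] at h1
    have h2 : s = t := mul_right_cancel₀ hpos h1
    subst h2
    have h3 : s • ξ + (X : Q.g) = s • ξ + (Y : Q.g) := hst
    rw [Subtype.ext (add_left_cancel h3)]
  · intro Z
    refine ⟨(Q.θ Z / Q.θ ξ, ⟨Z - (Q.θ Z / Q.θ ξ) • ξ, ?_⟩), ?_⟩
    · rw [mem_g₁]
      simp [hpos]
    · rw [hf]
      simp

/-! ### The Sasaki structure on the kernel of the Lee form -/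

theorem lee_map_horizontal (hc : Q.IsCentralPair ξ η) (X : Q.g) :
    Q.θ (Q.J (X - reebForm Q.J Q.θ ξ X • (η : Q.g))) = 0 := by
  rw [Q.vaisman.lee_map hc.lee]
  simp [hc.reebForm_reeb]

/-- The `(1, 1)`-tensor of the Sasaki structure on `ker θ`: it agrees with `J` on `ker ψ` and
vanishes at `η`. -/
noncomputable def sasakiTensor (hc : Q.IsCentralPair ξ η) : Q.g₁ →ₗ[ℝ] Q.g₁ where
  toFun X := ⟨Q.J (X - reebForm Q.J Q.θ ξ X • (η : Q.g)), hc.lee_map_horizontal X⟩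
  map_add' X Y := by
    apply Subtype.ext
    change Q.J ((X + Y : Q.g) - reebForm Q.J Q.θ ξ (X + Y) • (η : Q.g)) =
      Q.J (X - reebForm Q.J Q.θ ξ X • (η : Q.g)) + Q.J (Y - reebForm Q.J Q.θ ξ Y • (η : Q.g))
    simp only [map_add, map_sub, map_smul]
    module
  map_smul' a X := by
    apply Subtype.ext
    change Q.J (a • (X : Q.g) - reebForm Q.J Q.θ ξ (a • (X : Q.g)) • (η : Q.g)) =
      a • Q.J (X - reebForm Q.J Q.θ ξ X • (η : Q.g))
    simp only [map_sub, map_smul, smul_eq_mul]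
    module

theorem coe_sasakiTensor (hc : Q.IsCentralPair ξ η) (X : Q.g₁) :
    (hc.sasakiTensor X : Q.g) = Q.J (X - reebForm Q.J Q.θ ξ X • (η : Q.g)) := rfl

theorem coe_sasakiTensor_of_horizontal (hc : Q.IsCentralPair ξ η) {X : Q.g₁}
    (hX : reebForm Q.J Q.θ ξ X = 0) : (hc.sasakiTensor X : Q.g) = Q.J X := by
  rw [coe_sasakiTensor, hX, zero_smul, sub_zero]

theorem sasakiTensor_reeb (hc : Q.IsCentralPair ξ η) : hc.sasakiTensor η = 0 := by
  ext
  simp [coe_sasakiTensor, hc.reebForm_reeb]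

end IsCentralPair

/-- The metric of the Sasaki structure on `ker θ`: the given metric, rescaled along the Reeb field,
whose length for the given metric is that of the Lee field. -/
noncomputable def sasakiMetric (Q : VaismanPair.{u}) (ξ : Q.g) : LinearMap.BilinForm ℝ Q.g₁ :=
  LinearMap.mk₂ ℝ (fun X Y => Q.met X Y +
      (1 - Q.θ ξ) * (reebForm Q.J Q.θ ξ X * reebForm Q.J Q.θ ξ Y))
    (fun X Y Z => by simp; ring) (fun a X Y => by simp; ring)
    (fun X Y Z => by simp; ring) (fun a X Y => by simp; ring)

theorem sasakiMetric_apply (X Y : Q.g₁) : Q.sasakiMetric ξ X Y = Q.met X Y +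
    (1 - Q.θ ξ) * (reebForm Q.J Q.θ ξ X * reebForm Q.J Q.θ ξ Y) := rfl

namespace IsCentralPair

theorem form_reeb (hc : Q.IsCentralPair ξ η) (X : Q.g) :
    Q.met (η : Q.g) X = Q.θ ξ * reebForm Q.J Q.θ ξ X := by
  have hH := Q.vaisman.hermitian
  rw [hH.metric.congr_left hc.reeb, hH.form_map_left, hc.lee, Q.vaisman.lee_map hc.lee, neg_neg]

theorem isSasaki (hc : Q.IsCentralPair ξ η) :
    IsSasaki Q.h₁ (reebForm Q.J Q.θ ξ ∘ₗ Q.g₁.toSubmodule.subtype) η hc.sasakiTensor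
      (Q.sasakiMetric ξ) := by
  have hV := Q.vaisman
  have hH := hV.hermitian
  have hηc : ∀ X : Q.g₁, ⁅X, η⁆ = 0 := fun X => Subtype.ext (hc.reeb_central X)
  have hηc' : ∀ X : Q.g₁, ⁅η, X⁆ = 0 := fun X => by rw [← lie_skew, hηc, neg_zero]
  have hψη := hc.reebForm_reeb
  have hψlie : ∀ X Y : Q.g, reebForm Q.J Q.θ ξ ⁅X, Y⁆ = -(Q.θ ξ)⁻¹ * Q.θ (Q.J ⁅X, Y⁆) :=
    fun X Y => rfl
  have hψA : ∀ A ∈ Q.h, ∀ X : Q.g, reebForm Q.J Q.θ ξ ⁅A, X⁆ = 0 := fun A hA X => by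
    rw [hψlie, hV.lee_map_lie_isotropy hA, mul_zero]
  have hψJ : ∀ X : Q.g₁, reebForm Q.J Q.θ ξ (hc.sasakiTensor X) = 0 := fun X => by
    rw [coe_sasakiTensor, hV.reebForm_map]
    simp [lee_coe]
  refine ⟨?_, ?_, ?_, ?_, hψη, ?_, ?_, ?_, ?_, ⟨?_, ?_, ?_, ?_⟩, ?_, ?_, ?_, ?_⟩
  · exact fun A hA => hV.reebForm_isotropy hA
  · exact fun A hA X => hψA A hA X
  · intro X (hX : reebForm Q.J Q.θ ξ X = 0) hXY
    refine hH.metric.mem_of_self_eq_zero (X := (X : Q.g)) ?_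
    -- evaluate `dψ` at `J X`, which is again horizontal
    have h1 : -reebForm Q.J Q.θ ξ ⁅(X : Q.g), (hc.sasakiTensor X : Q.g)⁆ = 0 := hXY _ (hψJ X)
    rw [hc.coe_sasakiTensor_of_horizontal hX] at h1
    have h2 := hV.form_eq hc.lee X (Q.J X)
    rw [hH.form_map_map, hX, lee_coe] at h2
    linarith
  · intro A _
    rw [hηc]
    exact zero_mem _
  · intro X
    simp [dOne, hηc']
  · intro A (hA : (A : Q.g) ∈ Q.h)
    change (hc.sasakiTensor A : Q.g) ∈ Q.h
    rw [hc.coe_sasakiTensor_of_horizontal (hV.reebForm_isotropy hA)]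
    exact hH.complex.map_isotropy _ hA
  · intro A hA X
    have h1 := hH.complex.invariant A hA (X - reebForm Q.J Q.θ ξ X • (η : Q.g))
    change ⁅(A : Q.g), (hc.sasakiTensor X : Q.g)⁆ - (hc.sasakiTensor ⁅A, X⁆ : Q.g) ∈ Q.h
    rw [hc.coe_sasakiTensor_of_horizontal (X := ⁅A, X⁆) (hψA A hA X), coe_sasakiTensor]
    simpa [hc.reeb_central] using h1
  · intro X
    change (hc.sasakiTensor (hc.sasakiTensor X) : Q.g) -
      (-(X : Q.g) + reebForm Q.J Q.θ ξ X • (η : Q.g)) ∈ Q.h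
    rw [hc.coe_sasakiTensor_of_horizontal (hψJ X), coe_sasakiTensor]
    convert! hH.complex.sq (X - reebForm Q.J Q.θ ξ X • (η : Q.g)) using 1
    module
  · intro X Y
    rw [sasakiMetric_apply, sasakiMetric_apply, hH.metric.symm]
    ring
  · intro A (hA : (A : Q.g) ∈ Q.h) X
    rw [sasakiMetric_apply, hH.metric.isotropy A hA, hV.reebForm_isotropy hA]
    ring
  · intro X hX
    -- `g₁(X, X)` is the sum of `ψ(X)²` and of the square norm of the horizontal part of `X`
    have h1 : Q.sasakiMetric ξ X X = Q.met (X - reebForm Q.J Q.θ ξ X • (η : Q.g))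
        (X - reebForm Q.J Q.θ ξ X • (η : Q.g)) + reebForm Q.J Q.θ ξ X ^ 2 := by
      rw [sasakiMetric_apply]
      simp only [map_sub, map_smul, LinearMap.sub_apply, LinearMap.smul_apply, smul_eq_mul,
        hc.form_reeb, hH.metric.symm X η, hψη]
      ring
    rw [h1]
    by_cases h2 : reebForm Q.J Q.θ ξ X = 0
    · rw [h2]
      simpa using hH.metric.pos X hX
    · have h3 := hH.metric.self_nonneg (X - reebForm Q.J Q.θ ξ X • (η : Q.g))
      positivity
  · intro A hA X Y
    rw [sasakiMetric_apply, sasakiMetric_apply]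
    have h1 := hH.metric.invariant A hA X Y
    simp only [LieSubalgebra.coe_bracket, hψA A hA]
    linarith
  · intro X Y
    have h1 := hV.form_eq hc.lee (hc.sasakiTensor X) Y
    rw [hψJ, lee_coe, lee_coe, coe_sasakiTensor, hH.compatible] at h1
    simp only [map_sub, map_smul, LinearMap.sub_apply, LinearMap.smul_apply, smul_eq_mul,
      hc.form_reeb] at h1
    change _ = reebForm Q.J Q.θ ξ X * reebForm Q.J Q.θ ξ Y -
      reebForm Q.J Q.θ ξ ⁅(hc.sasakiTensor X : Q.g), (Y : Q.g)⁆
    rw [sasakiMetric_apply, coe_sasakiTensor]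
    simp only [map_sub, map_smul] at h1 ⊢
    linarith
  · intro X Y
    rw [hηc', hηc']
    simp
  · intro X Y (hX : reebForm Q.J Q.θ ξ X = 0) (hY : reebForm Q.J Q.θ ξ Y = 0)
    change reebForm Q.J Q.θ ξ (⁅(hc.sasakiTensor X : Q.g), (hc.sasakiTensor Y : Q.g)⁆ -
      ⁅(X : Q.g), (Y : Q.g)⁆) = 0
    rw [hc.coe_sasakiTensor_of_horizontal hX, hc.coe_sasakiTensor_of_horizontal hY, map_sub,
      hψlie, hψlie, hV.lee_map_lie_map_map, sub_self]
  · intro X Y (hX : reebForm Q.J Q.θ ξ X = 0) (hY : reebForm Q.J Q.θ ξ Y = 0)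
    -- the vertical corrections to the two last terms cancel
    have h1 : reebForm Q.J Q.θ ξ ⁅Q.J X, (Y : Q.g)⁆ +
        reebForm Q.J Q.θ ξ ⁅(X : Q.g), Q.J Y⁆ = 0 := by
      rw [hψlie, hψlie, hV.lee_map_lie_map_left]
      ring
    have h2 := hH.complex.integrable X Y
    change ⁅(hc.sasakiTensor X : Q.g), (hc.sasakiTensor Y : Q.g)⁆ - (⁅(X : Q.g), (Y : Q.g)⁆ +
      Q.J (⁅(hc.sasakiTensor X : Q.g), (Y : Q.g)⁆ -
        reebForm Q.J Q.θ ξ ⁅(hc.sasakiTensor X : Q.g), (Y : Q.g)⁆ • (η : Q.g)) +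
      Q.J (⁅(X : Q.g), (hc.sasakiTensor Y : Q.g)⁆ -
        reebForm Q.J Q.θ ξ ⁅(X : Q.g), (hc.sasakiTensor Y : Q.g)⁆ • (η : Q.g))) ∈ Q.h
    rw [hc.coe_sasakiTensor_of_horizontal hX, hc.coe_sasakiTensor_of_horizontal hY,
      eq_neg_of_add_eq_zero_left h1]
    convert! h2 using 1
    simp only [map_sub, map_smul]
    module

end IsCentralPair

end VaismanPair

namespace VaismanPair

/-! ### Making the Lee field and the Reeb field central -/

variable {P : VaismanPair.{u}} {ξ : P.g}

theorem lieDerivation_ad_apply {L : Type u} [LieRing L] [LieAlgebra ℝ L] (X Y : L) :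
    LieDerivation.ad ℝ L X Y = ⁅X, Y⁆ := by
  simp

theorem isCompatible_ad_lee (hξ : IsLeeVector P.met P.θ ξ) :
    P.IsCompatible (LieDerivation.ad ℝ P.g ξ) := by
  have hV := P.vaisman
  refine ⟨fun X Y => ?_, fun X hX => ?_, fun X => ?_⟩ <;>
    simp only [lieDerivation_ad_apply]
  · exact hV.killing ξ hξ X Y
  · rw [← lie_skew, neg_mem_iff]
    exact hV.lie_isotropy_lee hξ hX
  · exact hV.lie_lee_map hξ X

theorem isCompatible_ad_reeb (hξ : IsLeeVector P.met P.θ ξ) :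
    P.IsCompatible (LieDerivation.ad ℝ P.g (P.J ξ)) := by
  have hV := P.vaisman
  refine ⟨fun X Y => ?_, fun X hX => ?_, fun X => ?_⟩ <;>
    simp only [lieDerivation_ad_apply]
  · exact hV.killing_reeb hξ X Y
  · rw [← lie_skew, neg_mem_iff]
    exact hV.lie_isotropy_reeb hξ hX
  · exact hV.lie_reeb_map hξ X

/-- A unimodular Vaisman pair has a unimodular modification whose Lee field is central: twist by
`-|ξ|⁻² θ ⊗ ad ξ`. If the isotropy contains no nonzero abelian ideal, it contains no nonzero
central element of the modification. -/
theorem exists_isTwist_lee_central (P : VaismanPair.{u}) (hU : IsUnimodular P.g)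
    (hE : ∀ I : LieIdeal ℝ P.g, (∀ X ∈ I, X ∈ P.h) → (∀ X ∈ I, ∀ Y ∈ I, ⁅X, Y⁆ = 0) → I = ⊥) :
    ∃ Q : VaismanPair.{u}, P.IsTwist Q ∧ IsUnimodular Q.g ∧
      (∀ A ∈ Q.h, (∀ X : Q.g, ⁅X, A⁆ = 0) → A = 0) ∧
      ∃ ξ, IsLeeVector Q.met Q.θ ξ ∧ ∀ X : Q.g, ⁅X, ξ⁆ = 0 := by
  have hV := P.vaisman
  obtain ⟨ξ, hξ⟩ := hV.hermitian.metric.exists_isLeeVector hV.lee_isotropy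
  have hpos := (hV.lee_pos hξ).ne'
  let D : TwistData P.g :=
    { σ := LieDerivation.ad ℝ P.g ξ
      t := (-(P.θ ξ)⁻¹) • P.θ
      map_lie := fun X Y => by simp [hV.lee_lie]
      map_der := fun X => by simp [hV.lee_lie] }
  have hDσ : ∀ X, D.σ X = ⁅ξ, X⁆ := fun X => by simp [D]
  have hDt : ∀ X, D.t X = -(P.θ ξ)⁻¹ * P.θ X := fun X => rfl
  have hDθ : ∀ X, P.θ (D.σ X) = 0 := fun X => by rw [hDσ, hV.lee_lie]
  have hDc : P.IsCompatible D.σ := isCompatible_ad_lee hξ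
  refine ⟨P.twist D hDc hDθ, P.isTwist_twist D hDc hDθ, ?_, ?_, ξ, ?_, ?_⟩
  · apply Twisted.isUnimodular D hU
    rw [← hU ξ]
    congr 1
    ext X
    exact hDσ X
  · intro (A : P.g) (hA : A ∈ P.h) hAc
    -- the elements of the isotropy commuting with `ker θ` form an abelian ideal
    let I : LieIdeal ℝ P.g :=
      { carrier := {A | A ∈ P.h ∧ ∀ X, P.θ X = 0 → ⁅X, A⁆ = 0}
        add_mem' := fun {A B} hA hB => ⟨P.h.add_mem hA.1 hB.1, fun X hX => by
          rw [lie_add, hA.2 X hX, hB.2 X hX, add_zero]⟩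
        zero_mem' := ⟨P.h.zero_mem, fun X _ => lie_zero X⟩
        smul_mem' := fun a A hA => ⟨P.h.smul_mem a hA.1, fun X hX => by
          rw [lie_smul, hA.2 X hX, smul_zero]⟩
        lie_mem := by
          rintro X A ⟨hA, hA'⟩
          refine ⟨?_, fun Y hY => ?_⟩
          · have h1 : ⁅X - (P.θ X / P.θ ξ) • ξ, A⁆ = 0 := hA' _ (by simp [hpos])
            rw [sub_lie, smul_lie, sub_eq_zero] at h1
            change ⁅X, A⁆ ∈ P.h
            rw [h1, ← lie_skew]
            exact P.h.smul_mem _ (P.h.neg_mem (hV.lie_isotropy_lee hξ hA))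
          · rw [leibniz_lie, hA' Y hY, lie_zero, add_zero, hA' _ (hV.lee_lie Y X)] }
    have hI : I = ⊥ := hE I (fun X hX => hX.1)
      fun X hX Y hY => hY.2 X (hV.lee_isotropy X hX.1)
    have hAI : A ∈ I := by
      refine ⟨hA, fun X hX => ?_⟩
      have h1 : ⁅X, A⁆ + D.t X • D.σ A - D.t A • D.σ X = 0 := hAc X
      rw [hDt, hDt, hX, hV.lee_isotropy A hA] at h1
      simpa using h1
    rw [hI] at hAI
    exact hAI
  · exact hξ
  · intro (X : P.g)
    change ⁅X, ξ⁆ + D.t X • D.σ ξ - D.t ξ • D.σ X = (0 : P.g)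
    rw [hDt ξ, hDσ, hDσ, lie_self, neg_mul, inv_mul_cancel₀ hpos, ← lie_skew]
    simp

theorem isUnimodular_enlarge {σ : LieDerivation ℝ P.g P.g} (hU : IsUnimodular P.g)
    (hσ : LinearMap.trace ℝ P.g σ = 0) (hk : ∀ τ ∈ derLine σ, P.IsCompatible τ)
    (hθ : ∀ τ ∈ derLine σ, ∀ X, P.θ (τ X) = 0) : IsUnimodular (P.enlarge (derLine σ) hk hθ).g := by
  rintro ⟨X, τ, hτ⟩
  obtain ⟨a, rfl⟩ := mem_derLine.1 hτ
  -- the range of `ad` is contained in the ideal `g`, as `k` is abelian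
  let F : LieAlgebra.SemiDirectSum P.g (derLine σ) (derLine σ).incl →ₗ[ℝ] P.g :=
    LieAlgebra.SemiDirectSum.projl (derLine σ).incl ∘ₗ
      (LieAlgebra.ad ℝ _ (⟨X, a • σ, hτ⟩ : LieAlgebra.SemiDirectSum P.g (derLine σ) _) : _ →ₗ[ℝ] _)
  let G : P.g →ₗ[ℝ] LieAlgebra.SemiDirectSum P.g (derLine σ) (derLine σ).incl :=
    LieAlgebra.SemiDirectSum.inl (derLine σ).incl
  have h1 : LieAlgebra.ad ℝ (P.enlarge (derLine σ) hk hθ).g ⟨X, a • σ, hτ⟩ = G ∘ₗ F := by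
    refine LinearMap.ext ?_
    rintro ⟨Y, τ, hτ'⟩
    obtain ⟨b, rfl⟩ := mem_derLine.1 hτ'
    refine LieAlgebra.SemiDirectSum.ext rfl (Subtype.ext ?_)
    change ⁅a • σ, b • σ⁆ = 0
    simp
  have h2 : F ∘ₗ G = LieAlgebra.ad ℝ P.g X + a • (σ : P.g →ₗ[ℝ] P.g) := by
    ext Y
    change ⁅X, Y⁆ + a • σ Y - (0 : LieDerivation ℝ P.g P.g) X = ⁅X, Y⁆ + a • σ Y
    simp
  calc LinearMap.trace ℝ _ (LieAlgebra.ad ℝ (P.enlarge (derLine σ) hk hθ).g ⟨X, a • σ, hτ⟩)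
      = LinearMap.trace ℝ _ (G ∘ₗ F) := by rw [h1]; rfl
    _ = 0 := by
      rw [LinearMap.trace_comp_comm', h2]
      simp [hU X, hσ]

/-- A unimodular Vaisman pair with central Lee field has a unimodular modification whose Reeb field
is also represented by a central element. Unless this holds already, add `ad (J ξ)` to the isotropy:
then `J ξ - ad (J ξ)` is central. -/
theorem exists_isCentralPair (P : VaismanPair.{u}) (hU : IsUnimodular P.g)
    (h0 : ∀ A ∈ P.h, (∀ X : P.g, ⁅X, A⁆ = 0) → A = 0) {ξ : P.g} (hξ : IsLeeVector P.met P.θ ξ)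
    (hξc : ∀ X : P.g, ⁅X, ξ⁆ = 0) :
    ∃ Q : VaismanPair.{u}, P.IsModification Q ∧ IsUnimodular Q.g ∧
      (∀ A ∈ Q.h, (∀ X : Q.g, ⁅X, A⁆ = 0) → A = 0) ∧
      ∃ (ξ : Q.g) (η : Q.g₁), Q.IsCentralPair ξ η := by
  have hV := P.vaisman
  have hθJξ : P.θ (P.J ξ) = 0 := by rw [← hξ, hV.hermitian.form_map_self]
  by_cases hη : ∃ A ∈ P.h, ∀ X : P.g, ⁅X, P.J ξ + A⁆ = 0
  · obtain ⟨A, hA, hAc⟩ := hη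
    refine ⟨P, Relation.ReflTransGen.refl, hU, h0, ξ, ⟨P.J ξ + A, ?_⟩, hξ, ?_, hξc, hAc⟩
    · rw [mem_g₁, map_add, hθJξ, hV.lee_isotropy A hA, add_zero]
    · simpa using hA
  push Not at hη
  set σ := LieDerivation.ad ℝ P.g (P.J ξ)
  have hσ : ∀ X, σ X = ⁅P.J ξ, X⁆ := fun X => by simp [σ]
  have hk : ∀ τ ∈ derLine σ, P.IsCompatible τ :=
    P.isCompatible_derLine (isCompatible_ad_reeb hξ)
  have hθ : ∀ τ ∈ derLine σ, ∀ X, P.θ (τ X) = 0 := by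
    intro τ hτ X
    obtain ⟨a, rfl⟩ := mem_derLine.1 hτ
    simp [hσ, hV.lee_lie]
  have hneg : -σ ∈ derLine σ := mem_derLine.2 ⟨-1, by simp⟩
  refine ⟨P.enlarge (derLine σ) hk hθ,
    Relation.ReflTransGen.single (Or.inr (P.isEnlargement_enlarge _ hk hθ)), ?_, ?_,
    (⟨ξ, 0⟩ : LieAlgebra.SemiDirectSum P.g (derLine σ) (derLine σ).incl),
    ⟨(⟨P.J ξ, ⟨-σ, hneg⟩⟩ : LieAlgebra.SemiDirectSum P.g (derLine σ) (derLine σ).incl), hθJξ⟩,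
    ?_, ?_, ?_, ?_⟩
  · refine isUnimodular_enlarge hU ?_ hk hθ
    rw [← hU (P.J ξ)]
    congr 1
    ext X
    exact hσ X
  · rintro ⟨A, τ, hτ⟩ (hA : A ∈ P.h) hAc
    obtain ⟨a, rfl⟩ := mem_derLine.1 hτ
    have h1 : ∀ X : P.g, ⁅X, A + a • P.J ξ⁆ = 0 := by
      intro X
      have h2 : ⁅X, A⁆ + (0 : LieDerivation ℝ P.g P.g) A - a • σ X = 0 :=
        congrArg LieAlgebra.SemiDirectSum.left (hAc (⟨X, 0⟩ : LieAlgebra.SemiDirectSum _ _ _))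
      rw [LieDerivation.zero_apply, add_zero, hσ] at h2
      rw [lie_add, lie_smul, ← lie_skew X (P.J ξ), smul_neg, ← sub_eq_add_neg, h2]
    -- if `a ≠ 0`, then `J ξ + a⁻¹ A` would be central
    have ha : a = 0 := by
      by_contra ha
      obtain ⟨X, hX⟩ := hη (a⁻¹ • A) (P.h.smul_mem _ hA)
      apply hX
      have h3 : P.J ξ + a⁻¹ • A = a⁻¹ • (A + a • P.J ξ) := by
        rw [smul_add, smul_smul, inv_mul_cancel₀ ha, one_smul, add_comm]
      rw [h3, lie_smul, h1, smul_zero]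
    subst ha
    have hA0 : A = 0 := h0 A hA fun X => by simpa using h1 X
    exact LieAlgebra.SemiDirectSum.ext hA0 (Subtype.ext (zero_smul ℝ σ))
  · rintro ⟨X, τ⟩
    exact hξ X
  · change P.J ξ - P.J ξ ∈ P.h
    rw [sub_self]
    exact P.h.zero_mem
  · rintro ⟨X, τ, hτ⟩
    obtain ⟨a, rfl⟩ := mem_derLine.1 hτ
    refine LieAlgebra.SemiDirectSum.ext ?_ (Subtype.ext ?_)
    · change ⁅X, ξ⁆ + a • σ ξ - (0 : LieDerivation ℝ P.g P.g) X = 0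
      rw [hσ, hξc, hξc]
      simp
    · change ⁅a • σ, (0 : LieDerivation ℝ P.g P.g)⁆ = 0
      simp
  · rintro ⟨X, τ, hτ⟩
    obtain ⟨a, rfl⟩ := mem_derLine.1 hτ
    refine LieAlgebra.SemiDirectSum.ext ?_ (Subtype.ext ?_)
    · change ⁅X, P.J ξ⁆ + a • σ (P.J ξ) - (-σ X) = 0
      rw [hσ, hσ, lie_self, ← lie_skew]
      simp
    · change ⁅a • σ, -σ⁆ = 0
      simp

end VaismanPair

end HomVaisman

open VaismanPair

theorem proposition4p1 (P : VaismanPair.{u})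
    (hU : IsUnimodular P.g)
    (hE : ∀ I : LieIdeal ℝ P.g, (∀ X ∈ I, X ∈ P.h) → (∀ X ∈ I, ∀ Y ∈ I, ⁅X, Y⁆ = 0) → I = ⊥) :
    ∃ Q : VaismanPair.{u}, P.IsModification Q ∧ IsUnimodular Q.g ∧ IsUnimodular Q.g₁ ∧
      ∃ (ξ : Q.g) (η : Q.g₁) (ψ : Module.Dual ℝ Q.g),
        -- the Lee field and the Reeb field form a basis of the center
        IsLeeVector Q.met Q.θ ξ ∧ (η : Q.g) - Q.J ξ ∈ Q.h ∧
        LinearIndependent ℝ ![ξ, (η : Q.g)] ∧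
        (LieAlgebra.center ℝ Q.g).toSubmodule = Submodule.span ℝ {ξ, (η : Q.g)} ∧
        -- `g = ℝ × g₁` with `g₁ = ker θ ⊇ h`
        Q.h ≤ Q.g₁ ∧
        (∃ e : (ℝ × Q.g₁) ≃ₗ⁅ℝ⁆ Q.g, ∀ (t : ℝ) (X : Q.g₁), e (t, X) = t • ξ + (X : Q.g)) ∧
        -- `Ω = -θ ∧ ψ + dψ`
        (∀ A ∈ Q.h, ψ A = 0) ∧ ψ ξ = 0 ∧
        (∀ X Y, Q.Ω X Y = -wedgeOneOne Q.θ ψ X Y + dOne ψ X Y) ∧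
        -- `ψ` is the contact form of a Sasaki structure on `(g₁, h)` with Reeb field `η`; on the
        -- contact distribution it has the given complex structure and the given metric
        (∃ (J₁ : Q.g₁ →ₗ[ℝ] Q.g₁) (B₁ : LinearMap.BilinForm ℝ Q.g₁),
          IsSasaki Q.h₁ (ψ ∘ₗ Q.g₁.toSubmodule.subtype) η J₁ B₁ ∧
          J₁ η = 0 ∧
          (∀ X : Q.g₁, ψ X = 0 → (J₁ X : Q.g) = Q.J X) ∧
          (∀ X Y : Q.g₁, ψ X = 0 → B₁ X Y = Q.met X Y)) ∧
        -- `g₁` is a central extension of `g₂` by `ℝ`, and `(g₂, π(h))` is a Kähler algebra whose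
        -- Kähler form is induced by `dψ`
        ∃ (g₂ : Type u) (_ : LieRing g₂) (_ : LieAlgebra ℝ g₂)
          (i : ℝ →ₗ⁅ℝ⁆ Q.g₁) (π : Q.g₁ →ₗ⁅ℝ⁆ g₂)
          (J₂ : g₂ →ₗ[ℝ] g₂) (ω : LinearMap.BilinForm ℝ g₂),
          LieAlgebra.IsExtension i π ∧ (∀ (t : ℝ) (X : Q.g₁), ⁅i t, X⁆ = 0) ∧ i 1 = η ∧
          IsKahler (Q.h₁.map π) J₂ ω ∧
          (∀ X Y : Q.g₁, ω (π X) (π Y) = dOne ψ (X : Q.g) (Y : Q.g)) ∧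
          (∀ X : Q.g₁, ψ X = 0 → ∃ Y : Q.g₁, (Y : Q.g) = Q.J X ∧ J₂ (π X) = π Y) ∧
          -- `π(h)` is the stabilizer of `ψ` under the coadjoint action
          (∀ X : Q.g₁, π X ∈ Q.h₁.map π ↔ ∀ Y : Q.g₁, ψ ⁅(X : Q.g), (Y : Q.g)⁆ = 0) := by
  obtain ⟨P', hPP', hU', h0', ξ', hξ', hξc'⟩ := P.exists_isTwist_lee_central hU hE
  obtain ⟨Q, hP'Q, hUQ, h0, ξ, η, hc⟩ := P'.exists_isCentralPair hU' h0' hξ' hξc'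
  have hV := Q.vaisman
  have hS := hc.isSasaki
  have hηc : ∀ X : Q.g₁, ⁅X, η⁆ = 0 := fun X => Subtype.ext (hc.reeb_central X)
  have hη0 : η ≠ 0 := by
    rintro rfl
    simpa using hc.reebForm_reeb
  refine ⟨Q, Relation.ReflTransGen.head (Or.inl hPP') hP'Q, hUQ, isUnimodular_g₁ hUQ, ξ, η,
    reebForm Q.J Q.θ ξ, hc.lee, hc.reeb, hc.linearIndependent, hc.center_eq h0, Q.h_le_g₁,
    hc.exists_prodEquiv, fun A hA => hV.reebForm_isotropy hA, hV.reebForm_lee hc.lee, ?_,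
    ⟨hc.sasakiTensor, Q.sasakiMetric ξ, hS, hc.sasakiTensor_reeb,
      fun X hX => hc.coe_sasakiTensor_of_horizontal hX, ?_⟩,
    Q.g₁ ⧸ centralLine η hηc, inferInstance, inferInstance, centralIncl η, centralProj η hηc,
    quotientTensor hηc _ hS.reeb_form hc.sasakiTensor, quotientForm hηc _ hS.reeb_form,
    isExtension_central η hηc hη0, ?_, one_smul ℝ η, hS.isKahler hc.sasakiTensor_reeb,
    quotientForm_proj hηc _ hS.reeb_form, ?_, hS.proj_mem_iff_stabilizer⟩
  · intro X Y
    rw [VaismanPair.Ω, fundForm, hV.form_eq hc.lee, wedgeOneOne, dOne]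
    ring
  · intro X Y hX
    rw [sasakiMetric_apply, hX]
    ring
  · intro t X
    rw [← lie_skew, centralIncl_apply, lie_smul, hηc, smul_zero, neg_zero]
  · intro X hX
    exact ⟨hc.sasakiTensor X, hc.coe_sasakiTensor_of_horizontal hX,
      quotientTensor_proj hηc _ hS.reeb_form hc.sasakiTensor_reeb X⟩
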